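/- Let $\Lambda:\mathbb R\to\mathbb R$ be bounded and continuous, and suppose that there are real sequences $(\Lambda_n^{\pm})_{n\ge 0}$ with $$\Lambda(x)=\sum_{n=0}^{N-1}\frac{\Lambda^{\pm}_n}{x^{n}}+O(|x|^{-N}),\qquad x\to\pm\infty,\quad\text{for every } N\ge 0 .$$ Consider the Cauchy problem $$u_t=u_{xx}\quad (x\in\mathbb R,\ t>0),\qquad u(x,0)=\Lambda(x)\quad (x\in\mathbb R).$$ Here a bounded classical solution is a function that is bounded and continuous on $\mathbb R\times[0,\infty)$, is twice continuously differentiable in $x$ and differentiable in $t$ for $t>0$, and satisfies both relations. Put $\operatorname{erfc}(y)=\frac1{\sqrt\pi}\int_y^{\infty}e^{-s^2}\,ds$ (so that $\operatorname{erfc}(-\infty)=1$). **Theorem 1.** The problem has a bounded classical solution, and there are $C^\infty$ functions $H_{n,0},H_{n,1}:\mathbb R\to\mathbb R$, $n\ge1$, such that every bounded classical solution $u$ has, uniformly as $|x|+t\to\infty$, $x\in\mathbb R$, $t>0$, the asymptotic expansion $$u(x,t)=\Lambda^-_0\operatorname{erfc}(\eta)+\Lambda^+_0\operatorname{erfc}(-\eta)+\sum_{n=1}^{\infty}t^{-n/2}\bigl(H_{n,0}(\eta)+H_{n,1}(\eta)\ln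 t\bigr),\qquad \eta=\frac{x}{2\sqrt t},$$ in the following sense: for every $N\ge0$ there are constants $C,R$ such that for all $x\in\mathbb R$, $t>0$ with $|x|+t\ge R$ the difference between $u(x,t)$ and the right-hand side with the sum restricted to $1\le n\le N$ is at most $C\,(x^2+t)^{-(N+1)/2}\ln(x^2+t)$ in absolute value. Moreover, the $H_{n,1}$ are the Hermite functions $$H_{n,1}(\eta)=\frac{\Lambda^+_n-\Lambda^-_n}{4\sqrt\pi}\sum_{k=0}^{\lfloor (n-1)/2\rfloor}\frac{(-1)^k\,\eta^{\,n-2k-1}e^{-\eta^2}}{4^k\,k!\,(n-2k-1)!}.$$ -/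

import Mathlib

open Real Filter Asymptotics
open scoped ContDiff Nat

/-- `f` has the power asymptotic expansion `∑ₙ a n / x ^ n` along the filter `l`
(used with `l = atTop` and `l = atBot`): after `N` terms the remainder is `O(x ^ (-N))`. -/
def HasPowerExpansion (f : ℝ → ℝ) (a : ℕ → ℝ) (l : Filter ℝ) : Prop :=
  ∀ N : ℕ, (fun x : ℝ => f x - ∑ n ∈ Finset.range N, a n / x ^ n) =O[l] fun x : ℝ => (x ^ N)⁻¹

/-- `u x t` is a bounded classical solution of the Cauchy problem `u_t = u_xx` for `t > 0`,
`u(x, 0) = Λ(x)`: it is bounded and continuous on the closed half-plane `t ≥ 0`, is twice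
continuously differentiable in `x` and differentiable in `t` for `t > 0`, and satisfies the
equation there. (Nothing is required of the values of `u` at `t < 0`.) -/
structure IsBoundedHeatSolution (Λ : ℝ → ℝ) (u : ℝ → ℝ → ℝ) : Prop where
  bounded : ∃ C : ℝ, ∀ x t : ℝ, 0 ≤ t → |u x t| ≤ C
  continuousOn : ContinuousOn (fun p : ℝ × ℝ => u p.1 p.2) {p : ℝ × ℝ | 0 ≤ p.2}
  contDiff_space : ∀ t : ℝ, 0 < t → ContDiff ℝ 2 (fun y : ℝ => u y t)
  heat_eq : ∀ x t : ℝ, 0 < t →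
    HasDerivAt (fun s : ℝ => u x s) (iteratedDeriv 2 (fun y : ℝ => u y t) x) t
  initial : ∀ x : ℝ, u x 0 = Λ x

/-- The complementary error function normalised by `erfc (-∞) = 1`,
that is `π ^ (-1/2) ∫_x^∞ exp (-s²) ds`. -/
noncomputable def erfc (x : ℝ) : ℝ :=
  (1 / √π) * ∫ s in Set.Ioi x, Real.exp (-s ^ 2)

/-- The Hermite function `∑ₖ (-1)ᵏ η^(j-2k) exp (-η²) / (4ᵏ k! (j-2k)!)`, `0 ≤ k ≤ ⌊j/2⌋`, which is
`exp (-η²) / (2 ^ j * j!)` times the `j`-th (physicists') Hermite polynomial at `η`. -/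
noncomputable def hermiteFun (j : ℕ) (η : ℝ) : ℝ :=
  ∑ k ∈ Finset.range (j / 2 + 1),
    (-1) ^ k * η ^ (j - 2 * k) * Real.exp (-η ^ 2) / (4 ^ k * (k ! : ℝ) * ((j - 2 * k)! : ℝ))

/-! Write `g w = exp (-w ^ 2)`, `σ = 2√t`, `η = x / σ`. The Poisson integral is `π ^ (-1/2) ∫ g (η -
z) Λ (σ z) dz`; it is a bounded classical solution (`isBoundedHeatSolution_heatSol`), and the
maximum principle shows that every other one agrees with it for `t > 0`
(`IsBoundedHeatSolution.eq_of_pos`). It remains to expand this integral. Split it at `z = 0` and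
reflect the negative half, so that only half-line integrals occur.

On `z > 0` let `T_k` be the remainder of `g (η - z)` after `k` Taylor terms in `z`, let `R_k` be the
remainder of `Λ` after `k` terms of its expansion, and put `I_k = ∫ T_k(z) R_{k+1}(σ z) dz`. Near
`0` the zero of order `k` of `T_k` absorbs the pole of `R_{k+1}`; at infinity the decay of `R_{k+1}`
absorbs the growth of `T_k`. So every `I_k` converges, and `I_0` is the half-line integral minus its
`erfc` term.

The difference `I_k - I_{k+1}` is computed exactly (`integral_taylorRem_mul_powerRem_sub`). It is `σ
^ (-k-1)` times the sum of a Taylor coefficient of `g` times a regularised moment of `Λ`, and the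
coefficient of index `k + 1` of `Λ` times a finite part of `∫ g (η - z) / z ^ (k+1)`. The finite
part appears with cut-off at `σ z = 1`; moving the cut-off to `z = 1` costs `log σ` times a
derivative of the Gaussian. This is the only source of logarithms, and the reason why their
coefficients are Hermite functions.

Telescoping leaves `I_N` as the error. Its bound (`exists_abs_integral_taylorRem_mul_powerRem_le`)
depends only on `σ (1 + |η|) = 2√t + |x|`, so the expansion is uniform also where `t` is small and
`|x|` is large. -/

theorem contDiff_of_hasDerivAt_seq {f : ℕ → ℝ → ℝ}
    (hf : ∀ k w, HasDerivAt (f k) (f (k + 1) w) w) (k : ℕ) : ContDiff ℝ ∞ (f k) := by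
  rw [contDiff_infty]
  intro n
  induction n generalizing k with
  | zero =>
    exact contDiff_zero.2 (continuous_iff_continuousAt.2 fun w => (hf k w).continuousAt)
  | succ n ih =>
    have h : deriv (f k) = f (k + 1) := funext fun w => (hf k w).deriv
    have := (contDiff_succ_iff_deriv (F := ℝ) (f := f k) (n := n)).2
      ⟨fun w => (hf k w).differentiableAt, by simp, by rw [h]; exact ih (k + 1)⟩
    exact_mod_cast this

/-! ### Hermite functions and the derivatives of the Gaussian. -/

/-- A sequence of functions, each the derivative of the preceding one, all of rapid decay. -/
structure IsRapidDerivSeq (g : ℕ → ℝ → ℝ) : Prop where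
  hasDerivAt : ∀ k w, HasDerivAt (g k) (g (k + 1) w) w
  decay : ∀ k m : ℕ, ∃ C, ∀ w, |g k w| * (1 + |w|) ^ m ≤ C

/-- The `k`-th monomial of `exp (η ^ 2) * hermiteFun j η`, extended by zero to all `k`. -/
noncomputable def hermiteTerm (j k : ℕ) (η : ℝ) : ℝ :=
  if 2 * k ≤ j then (-1) ^ k * η ^ (j - 2 * k) / (4 ^ k * (k ! : ℝ) * ((j - 2 * k)! : ℝ)) else 0

/-- The polynomial factor of `hermiteFun j`. -/
noncomputable def hermitePoly (j : ℕ) (η : ℝ) : ℝ :=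
  ∑ k ∈ Finset.range (j + 1), hermiteTerm j k η

theorem hermitePoly_eq_sum_range {j M : ℕ} (hM : j / 2 < M) (η : ℝ) :
    hermitePoly j η = ∑ k ∈ Finset.range M, hermiteTerm j k η := by
  have key : ∀ M, j / 2 < M → ∑ k ∈ Finset.range (j / 2 + 1), hermiteTerm j k η
      = ∑ k ∈ Finset.range M, hermiteTerm j k η := by
    intro M hM
    apply Finset.sum_subset
    · intro k hk
      simp only [Finset.mem_range] at hk ⊢
      omega
    · intro k _ hk
      simp only [Finset.mem_range] at hk
      exact if_neg (by omega)
  rw [hermitePoly, ← key M hM, ← key (j + 1) (by omega)]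

theorem hermiteFun_eq (j : ℕ) (η : ℝ) : hermiteFun j η = hermitePoly j η * Real.exp (-η ^ 2) := by
  rw [hermitePoly_eq_sum_range (Nat.lt_succ_self (j / 2)), hermiteFun, Finset.sum_mul]
  refine Finset.sum_congr rfl fun k hk => ?_
  rw [Finset.mem_range] at hk
  rw [hermiteTerm, if_pos (by omega)]
  ring

/-- The normalisation by factorials makes the polynomial factors an Appell sequence, term by term.
Extending the terms by zero spares any care about the range of summation. -/
theorem hasDerivAt_hermiteTerm (j k : ℕ) (η : ℝ) :
    HasDerivAt (hermiteTerm (j + 1) k) (hermiteTerm j k η) η := by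
  by_cases h : 2 * k ≤ j
  · obtain ⟨d, rfl⟩ := Nat.exists_eq_add_of_le h
    have e1 : hermiteTerm (2 * k + d + 1) k
        = fun η => (-1) ^ k * η ^ (d + 1) / (4 ^ k * (k ! : ℝ) * ((d + 1)! : ℝ)) := by
      funext y
      rw [hermiteTerm, if_pos (by omega), show 2 * k + d + 1 - 2 * k = d + 1 by omega]
    rw [e1, hermiteTerm, if_pos h, show 2 * k + d - 2 * k = d by omega]
    refine (((hasDerivAt_pow (d + 1) η).const_mul ((-1) ^ k)).div_const _).congr_deriv ?_
    rw [Nat.factorial_succ]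
    push_cast
    have : (d : ℝ) + 1 ≠ 0 := by positivity
    have : (k ! : ℝ) ≠ 0 := by positivity
    have : (d ! : ℝ) ≠ 0 := by positivity
    field_simp
    try simp
  · rw [hermiteTerm, if_neg h]
    by_cases h2 : 2 * k ≤ j + 1
    · have e1 : hermiteTerm (j + 1) k
          = fun η => (-1) ^ k / (4 ^ k * (k ! : ℝ)) := by
        funext y
        rw [hermiteTerm, if_pos h2, show j + 1 - 2 * k = 0 by omega]
        simp
      rw [e1]
      exact hasDerivAt_const _ _
    · have e1 : hermiteTerm (j + 1) k = fun η => 0 := by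
        funext y
        rw [hermiteTerm, if_neg h2]
      rw [e1]
      exact hasDerivAt_const _ _

theorem hasDerivAt_hermitePoly (j : ℕ) (η : ℝ) :
    HasDerivAt (hermitePoly (j + 1)) (hermitePoly j η) η := by
  rw [hermitePoly_eq_sum_range (j := j) (M := j + 2) (by omega)]
  exact HasDerivAt.fun_sum fun k _ => hasDerivAt_hermiteTerm j k η

theorem hermiteTerm_zero_recurrence (j : ℕ) (η : ℝ) :
    2 * (j + 1) * hermiteTerm (j + 1) 0 η = 2 * η * hermiteTerm j 0 η := by
  have : ((j ! : ℕ) : ℝ) ≠ 0 := by positivity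
  have : (j : ℝ) + 1 ≠ 0 := by positivity
  simp [hermiteTerm, Nat.factorial_succ]
  field_simp
  ring

theorem hermiteTerm_succ_recurrence (j k : ℕ) (η : ℝ) :
    2 * (j + 2) * hermiteTerm (j + 2) (k + 1) η
      = 2 * η * hermiteTerm (j + 1) (k + 1) η - hermiteTerm j k η := by
  by_cases h : 2 * k ≤ j
  · obtain ⟨d, rfl⟩ := Nat.exists_eq_add_of_le h
    have hk : (k ! : ℝ) ≠ 0 := by positivity
    have hk' : (k : ℝ) + 1 ≠ 0 := by positivity
    rw [hermiteTerm, if_pos (by omega), hermiteTerm, hermiteTerm, if_pos h,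
      show 2 * k + d + 2 - 2 * (k + 1) = d by omega, show 2 * k + d - 2 * k = d by omega]
    rcases d with _ | d
    · rw [if_neg (by omega)]
      simp only [Nat.factorial_succ]
      push_cast
      field_simp
      ring
    · rw [if_pos (by omega), show 2 * k + (d + 1) + 1 - 2 * (k + 1) = d by omega]
      have hd : (d ! : ℝ) ≠ 0 := by positivity
      have hd' : (d : ℝ) + 1 ≠ 0 := by positivity
      simp only [Nat.factorial_succ]
      push_cast
      field_simp
      ring
  · simp only [hermiteTerm]
    rw [if_neg h, if_neg (by omega), if_neg (by omega)]
    simp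

theorem hermitePoly_one (η : ℝ) : hermitePoly 1 η = η := by
  simp [hermitePoly, hermiteTerm, Finset.sum_range_succ]

theorem hermitePoly_zero (η : ℝ) : hermitePoly 0 η = 1 := by
  simp [hermitePoly, hermiteTerm]

theorem hermitePoly_recurrence (j : ℕ) (η : ℝ) :
    2 * (j + 2) * hermitePoly (j + 2) η = 2 * η * hermitePoly (j + 1) η - hermitePoly j η := by
  rw [hermitePoly_eq_sum_range (j := j + 2) (M := j + 3) (by omega),
    hermitePoly_eq_sum_range (j := j + 1) (M := j + 3) (by omega),
    hermitePoly_eq_sum_range (j := j) (M := j + 2) (by omega),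
    Finset.sum_range_succ', Finset.sum_range_succ' _ (j + 2), mul_add (2 * ((j : ℝ) + 2)), mul_add (2 * η),
    Finset.mul_sum, Finset.mul_sum, add_sub_right_comm, ← Finset.sum_sub_distrib]
  congr 1
  · exact Finset.sum_congr rfl fun k _ => hermiteTerm_succ_recurrence j k η
  · have := hermiteTerm_zero_recurrence (j + 1) η
    push_cast at this
    rw [← this]
    ring

theorem hasDerivAt_exp_neg_sq (η : ℝ) :
    HasDerivAt (fun η : ℝ => Real.exp (-η ^ 2)) (-2 * η * Real.exp (-η ^ 2)) η := by
  refine ((hasDerivAt_pow 2 η).fun_neg.exp).congr_deriv ?_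
  push_cast
  ring

/-- By the Appell property the product rule gives `P_j - 2 η P_{j+1}` as the new polynomial factor,
and the three-term recurrence identifies it as `-2 (j + 2) P_{j+2}`. -/
theorem hasDerivAt_hermiteFun (j : ℕ) (η : ℝ) :
    HasDerivAt (hermiteFun j) (-2 * (j + 1) * hermiteFun (j + 1) η) η := by
  rw [show hermiteFun j = fun η => hermitePoly j η * Real.exp (-η ^ 2) from
    funext (hermiteFun_eq j), hermiteFun_eq]
  rcases j with _ | j
  · have : hermitePoly 0 = fun _ => (1 : ℝ) := funext hermitePoly_zero
    rw [this]
    refine ((hasDerivAt_exp_neg_sq η).const_mul 1).congr_deriv ?_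
    rw [hermitePoly_one]
    push_cast
    ring
  · refine ((hasDerivAt_hermitePoly j η).mul (hasDerivAt_exp_neg_sq η)).congr_deriv ?_
    have := hermitePoly_recurrence j η
    push_cast
    linear_combination Real.exp (-η ^ 2) * this

/-- The `k`-th derivative of `exp (-w ^ 2)`. -/
noncomputable def gaussDeriv (k : ℕ) (w : ℝ) : ℝ := (-2) ^ k * (k ! : ℝ) * hermiteFun k w

theorem gaussDeriv_zero (w : ℝ) : gaussDeriv 0 w = Real.exp (-w ^ 2) := by
  simp [gaussDeriv, hermiteFun_eq, hermitePoly_zero]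

theorem gaussDeriv_one (w : ℝ) : gaussDeriv 1 w = -2 * w * Real.exp (-w ^ 2) := by
  simp [gaussDeriv, hermiteFun_eq, hermitePoly_one]
  ring

theorem gaussDeriv_two (w : ℝ) : gaussDeriv 2 w = (4 * w ^ 2 - 2) * Real.exp (-w ^ 2) := by
  have := hermitePoly_recurrence 0 w
  rw [hermitePoly_zero, hermitePoly_one] at this
  simp only [gaussDeriv, hermiteFun_eq, Nat.factorial]
  push_cast at this ⊢
  linear_combination 2 * Real.exp (-w ^ 2) * this

theorem abs_hermitePoly_le (j : ℕ) : ∃ C, 0 ≤ C ∧ ∀ w, |hermitePoly j w| ≤ C * (1 + |w|) ^ j := by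
  refine ⟨∑ k ∈ Finset.range (j + 1), 1, by positivity, fun w => ?_⟩
  rw [hermitePoly, Finset.sum_mul]
  refine (Finset.abs_sum_le_sum_abs _ _).trans (Finset.sum_le_sum fun k _ => ?_)
  rw [hermiteTerm, one_mul]
  split_ifs with h
  · have h1 : (1 : ℝ) ≤ 4 ^ k * (k ! : ℝ) * ((j - 2 * k)! : ℝ) := by
      exact_mod_cast Nat.succ_le_of_lt (by positivity : 0 < 4 ^ k * k ! * (j - 2 * k)!)
    rw [abs_div, abs_mul, abs_pow, abs_neg, abs_one, one_pow, one_mul, abs_pow,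
      abs_of_pos (by positivity : (0 : ℝ) < 4 ^ k * (k ! : ℝ) * ((j - 2 * k)! : ℝ))]
    refine (div_le_self (by positivity) h1).trans ?_
    calc |w| ^ (j - 2 * k) ≤ (1 + |w|) ^ (j - 2 * k) := by gcongr; linarith
      _ ≤ (1 + |w|) ^ j := pow_le_pow_right₀ (by linarith [abs_nonneg w]) (by omega)
  · simp only [abs_zero]
    positivity

theorem pow_mul_exp_neg_sq_le (m : ℕ) (w : ℝ) :
    (1 + |w|) ^ m * Real.exp (-w ^ 2) ≤ (m ! : ℝ) * Real.exp 2 := by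
  have h1 := Real.pow_div_factorial_le_exp (1 + |w|) (by positivity) m
  rw [div_le_iff₀ (by positivity)] at h1
  calc (1 + |w|) ^ m * Real.exp (-w ^ 2)
      ≤ Real.exp (1 + |w|) * (m ! : ℝ) * Real.exp (-w ^ 2) := by gcongr
    _ = (m ! : ℝ) * Real.exp (1 + |w| + -w ^ 2) := by rw [Real.exp_add (1 + |w|)]; ring
    _ ≤ (m ! : ℝ) * Real.exp 2 := by
      gcongr
      -- `w ^ 2 ≥ 2 |w| - 1`, hence `1 + |w| - w ^ 2 ≤ 2 - |w| ≤ 2`.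
      nlinarith [sq_nonneg (|w| - 1), sq_abs w]

theorem isRapidDerivSeq_gaussDeriv : IsRapidDerivSeq gaussDeriv where
  hasDerivAt k w := by
    refine ((hasDerivAt_hermiteFun k w).const_mul ((-2) ^ k * (k ! : ℝ))).congr_deriv ?_
    rw [gaussDeriv, Nat.factorial_succ]
    push_cast
    ring
  decay k m := by
    obtain ⟨C, hC, h⟩ := abs_hermitePoly_le k
    refine ⟨2 ^ k * (k ! : ℝ) * (C * (((k + m)! : ℝ) * Real.exp 2)), fun w => ?_⟩
    rw [gaussDeriv, hermiteFun_eq]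
    simp only [abs_mul, abs_pow, abs_neg, Nat.abs_ofNat, Nat.abs_cast, Real.abs_exp]
    calc 2 ^ k * (k ! : ℝ) * (|hermitePoly k w| * Real.exp (-w ^ 2)) * (1 + |w|) ^ m
        ≤ 2 ^ k * (k ! : ℝ) * (C * (1 + |w|) ^ k * Real.exp (-w ^ 2)) * (1 + |w|) ^ m := by
          gcongr
          exact h w
      _ = 2 ^ k * (k ! : ℝ) * (C * ((1 + |w|) ^ (k + m) * Real.exp (-w ^ 2))) := by
          rw [pow_add]; ring
      _ ≤ _ := mul_le_mul_of_nonneg_left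
          (mul_le_mul_of_nonneg_left (pow_mul_exp_neg_sq_le _ _) hC) (by positivity)

namespace IsRapidDerivSeq

variable {g : ℕ → ℝ → ℝ}

theorem continuous (hg : IsRapidDerivSeq g) (k : ℕ) : Continuous (g k) :=
  (contDiff_of_hasDerivAt_seq hg.hasDerivAt k).continuous

theorem exists_abs_le (hg : IsRapidDerivSeq g) (k m : ℕ) :
    ∃ C, 0 ≤ C ∧ ∀ w, |g k w| ≤ C * ((1 + |w|) ^ m)⁻¹ := by
  obtain ⟨C, hC⟩ := hg.decay k m
  refine ⟨C, le_trans (by positivity) (hC 0), fun w => ?_⟩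
  rw [← div_eq_mul_inv, le_div_iff₀ (by positivity)]
  exact hC w

theorem exists_bound (hg : IsRapidDerivSeq g) (k : ℕ) : ∃ C, 0 ≤ C ∧ ∀ w, |g k w| ≤ C := by
  simpa using hg.exists_abs_le k 0

theorem integrable (hg : IsRapidDerivSeq g) (k : ℕ) : MeasureTheory.Integrable (g k) := by
  obtain ⟨C, -, hC⟩ := hg.exists_abs_le k 2
  have h : MeasureTheory.Integrable fun w : ℝ => C * (1 + w ^ 2)⁻¹ :=
    integrable_inv_one_add_sq.const_mul C
  refine h.mono' (hg.continuous k).aestronglyMeasurable (Eventually.of_forall fun w => ?_)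
  have hC0 : 0 ≤ C := le_trans (abs_nonneg _) (by simpa using hC 0)
  refine (hC w).trans ?_
  gcongr
  nlinarith [abs_nonneg w, sq_abs w]

end IsRapidDerivSeq

/-! ### Taylor remainders of a rapidly decaying function. -/

/-- The remainder of the Taylor polynomial with `n` terms of `z ↦ g j (η - z)` at `0`, for a
sequence `g` of successive derivatives. -/
noncomputable def taylorRem (g : ℕ → ℝ → ℝ) (j n : ℕ) (η z : ℝ) : ℝ :=
  g j (η - z) - ∑ i ∈ Finset.range n, (-1) ^ i / (i ! : ℝ) * g (j + i) η * z ^ i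

theorem taylorRem_zero (g : ℕ → ℝ → ℝ) (j : ℕ) (η z : ℝ) : taylorRem g j 0 η z = g j (η - z) := by
  simp [taylorRem]

theorem taylorRem_succ (g : ℕ → ℝ → ℝ) (j n : ℕ) (η z : ℝ) :
    taylorRem g j (n + 1) η z
      = taylorRem g j n η z - (-1) ^ n / (n ! : ℝ) * g (j + n) η * z ^ n := by
  rw [taylorRem, taylorRem, Finset.sum_range_succ]
  ring

theorem taylorRem_succ_apply_zero (g : ℕ → ℝ → ℝ) (j n : ℕ) (η : ℝ) :
    taylorRem g j (n + 1) η 0 = 0 := by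
  simp [taylorRem, Finset.sum_range_succ']

section
variable {g : ℕ → ℝ → ℝ}

theorem hasDerivAt_taylorRem_right (hg : ∀ k w, HasDerivAt (g k) (g (k + 1) w) w) (j n : ℕ)
    (η z : ℝ) : HasDerivAt (taylorRem g j (n + 1) η) (-taylorRem g (j + 1) n η z) z := by
  have h1 : HasDerivAt (fun z => g j (η - z)) (-g (j + 1) (η - z)) z := by
    exact (hg j (η - z)).comp_const_sub η z
  have h2 : HasDerivAt
      (fun z => ∑ i ∈ Finset.range (n + 1), (-1) ^ i / (i ! : ℝ) * g (j + i) η * z ^ i)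
      (∑ i ∈ Finset.range (n + 1),
        (-1) ^ i / (i ! : ℝ) * g (j + i) η * ((i : ℝ) * z ^ (i - 1))) z :=
    HasDerivAt.fun_sum fun i _ => (hasDerivAt_pow i z).const_mul _
  refine (h1.sub h2).congr_deriv ?_
  rw [taylorRem, Finset.sum_range_succ']
  simp only [Nat.cast_zero, zero_mul, mul_zero, add_zero, neg_sub_left, neg_sub]
  have : ∀ i : ℕ, (-1) ^ (i + 1) / ((i + 1)! : ℝ) * g (j + (i + 1)) η
        * (((i + 1 : ℕ) : ℝ) * z ^ (i + 1 - 1))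
      = -((-1) ^ i / (i ! : ℝ) * g (j + 1 + i) η * z ^ i) := by
    intro i
    rw [Nat.factorial_succ, show j + (i + 1) = j + 1 + i by ring, Nat.add_sub_cancel]
    push_cast
    have h3 : (i ! : ℝ) ≠ 0 := by positivity
    have h4 : (i : ℝ) + 1 ≠ 0 := by positivity
    field_simp
    ring
  simp only [this, Finset.sum_neg_distrib]
  ring

theorem hasDerivAt_taylorRem_left (hg : ∀ k w, HasDerivAt (g k) (g (k + 1) w) w) (j n : ℕ)
    (η z : ℝ) : HasDerivAt (fun η => taylorRem g j n η z) (taylorRem g (j + 1) n η z) η := by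
  have h1 : HasDerivAt (fun η => g j (η - z)) (g (j + 1) (η - z)) η := by
    exact (hg j (η - z)).comp_sub_const η z
  refine h1.sub (HasDerivAt.fun_sum fun i _ => ?_)
  rw [show j + 1 + i = j + i + 1 by ring]
  exact ((hg (j + i) η).const_mul _).mul_const _

/-- Differentiation in `z` gives minus the remainder of the next derivative with one term fewer, so
the mean value inequality yields an induction. The factor `1 / n!` is given away. -/
theorem abs_taylorRem_le (hg : ∀ k w, HasDerivAt (g k) (g (k + 1) w) w) {B η : ℝ} (n : ℕ) :
    ∀ {j : ℕ} {z : ℝ}, 0 ≤ z → (∀ s ∈ Set.Icc 0 z, |g (j + n) (η - s)| ≤ B) →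
      |taylorRem g j n η z| ≤ B * z ^ n := by
  induction n with
  | zero =>
    intro j z hz hB
    simpa [taylorRem_zero] using hB z ⟨hz, le_rfl⟩
  | succ n ih =>
    intro j z hz hB
    have hB0 : 0 ≤ B := (abs_nonneg _).trans (hB 0 ⟨le_rfl, hz⟩)
    have h := Convex.norm_image_sub_le_of_norm_hasDerivWithin_le
      (f := taylorRem g j (n + 1) η) (f' := fun s => -taylorRem g (j + 1) n η s)
      (s := Set.Icc 0 z) (C := B * z ^ n) (x := 0) (y := z)
      (fun s _ => (hasDerivAt_taylorRem_right hg j n η s).hasDerivWithinAt)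
      (fun s hs => by
        rw [norm_neg, Real.norm_eq_abs]
        refine (ih hs.1 fun r hr => ?_).trans ?_
        · rw [show j + 1 + n = j + (n + 1) by ring]
          exact hB r ⟨hr.1, hr.2.trans hs.2⟩
        · have := hs.1
          have := hs.2
          gcongr)
      (convex_Icc 0 z) ⟨le_rfl, hz⟩ ⟨hz, le_rfl⟩
    rw [taylorRem_succ_apply_zero, sub_zero, sub_zero, Real.norm_eq_abs, Real.norm_eq_abs,
      abs_of_nonneg hz] at h
    rw [pow_succ, ← mul_assoc]
    exact h

theorem continuous_taylorRem (hg : IsRapidDerivSeq g) (j n : ℕ) (η : ℝ) :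
    Continuous (taylorRem g j n η) := by
  have := hg.continuous j
  unfold taylorRem
  fun_prop

theorem exists_abs_taylorRem_le (hg : IsRapidDerivSeq g) (j n : ℕ) :
    ∃ C, 0 ≤ C ∧ ∀ η z, 0 ≤ z → |taylorRem g j n η z| ≤ C * z ^ n := by
  obtain ⟨C, h0, hC⟩ := hg.exists_bound (j + n)
  exact ⟨C, h0, fun η z hz => abs_taylorRem_le hg.hasDerivAt n hz fun s _ => hC _⟩

/-- For these `z` the whole segment from `η` to `η - z` stays at distance comparable to `1 + |η|`
from the origin, so the derivative in the Taylor bound is small. The power `n + 1` is the one the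
final error estimate needs. -/
theorem exists_abs_taylorRem_le_of_le (hg : IsRapidDerivSeq g) (j n : ℕ) :
    ∃ C, 0 ≤ C ∧ ∀ η z, 0 ≤ z → z ≤ (1 + |η|) / 2 →
      |taylorRem g j n η z| ≤ C * ((1 + |η|) ^ (n + 1))⁻¹ * z ^ n := by
  obtain ⟨C, h0, hC⟩ := hg.exists_abs_le (j + n) (n + 1)
  refine ⟨C * 2 ^ (n + 1), by positivity, fun η z hz hz' =>
    abs_taylorRem_le hg.hasDerivAt n hz fun s hs => (hC _).trans ?_⟩
  have h1 : (1 + |η|) / 2 ≤ 1 + |η - s| := by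
    have h2 := abs_sub_abs_le_abs_sub η s
    rw [abs_of_nonneg hs.1] at h2
    linarith [hs.2]
  have h3 : C * 2 ^ (n + 1) * ((1 + |η|) ^ (n + 1))⁻¹
      = C * (((1 + |η|) / 2) ^ (n + 1))⁻¹ := by
    rw [div_pow, inv_div]
    ring
  rw [h3]
  gcongr

/-- For large `z` the Taylor polynomial is bounded term by term. The value `g j (η - z)` is kept,
since it is not small near `z = η`; later only its integral is used. -/
theorem exists_abs_taylorRem_le_of_ge (hg : IsRapidDerivSeq g) (j n : ℕ) :
    ∃ C, 0 ≤ C ∧ ∀ η z, (1 + |η|) / 2 ≤ z →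
      |taylorRem g j n η z| ≤ |g j (η - z)| + C * ((1 + |η|) ^ n)⁻¹ * (z ^ n * z⁻¹) := by
  have h : ∀ i, ∃ C, 0 ≤ C ∧ ∀ η z, (1 + |η|) / 2 ≤ z → i < n →
      |(-1) ^ i / (i ! : ℝ) * g (j + i) η * z ^ i|
        ≤ C * ((1 + |η|) ^ n)⁻¹ * (z ^ n * z⁻¹) := by
    intro i
    obtain ⟨C, h0, hC⟩ := hg.exists_abs_le (j + i) (i + 1)
    refine ⟨C * 2 ^ n, by positivity, fun η z hz hi => ?_⟩
    obtain ⟨d, rfl⟩ := Nat.exists_eq_add_of_le (Nat.succ_le_of_lt hi)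
    have hz0 : 0 < z := lt_of_lt_of_le (by positivity) hz
    -- Here `n = i + 1 + d`: the `d` missing powers of `(1 + |η|)⁻¹` are traded for `d` powers of
    -- `z`.
    have hl : (1 + |η|) ^ d ≤ 2 ^ d * z ^ d := by
      rw [← mul_pow]
      gcongr
      linarith
    rw [abs_mul, abs_mul, abs_div, abs_pow, abs_neg, abs_one, one_pow, Nat.abs_cast,
      abs_of_pos (pow_pos hz0 i)]
    have h1 : 1 / (i ! : ℝ) ≤ 1 := by
      rw [div_le_one (by positivity)]
      exact_mod_cast Nat.succ_le_of_lt (Nat.factorial_pos i)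
    calc 1 / (i ! : ℝ) * |g (j + i) η| * z ^ i
        ≤ 1 * (C * ((1 + |η|) ^ (i + 1))⁻¹) * z ^ i := by
          gcongr
          exact hC η
      _ = C * ((1 + |η|) ^ (i + 1 + d))⁻¹ * z ^ i * (1 + |η|) ^ d := by
          have : (1 + |η|) ≠ 0 := by positivity
          field_simp
          ring
      _ ≤ C * ((1 + |η|) ^ (i + 1 + d))⁻¹ * z ^ i * (2 ^ d * z ^ d) := by gcongr
      _ ≤ C * ((1 + |η|) ^ (i + 1 + d))⁻¹ * z ^ i * (2 ^ (i + 1 + d) * z ^ d) := by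
          gcongr
          · norm_num
          · omega
      _ = _ := by
          rw [show z ^ (i.succ + d) = z ^ i * z ^ d * z by rw [Nat.succ_eq_add_one]; ring]
          field_simp
  choose C h0 hC using h
  refine ⟨∑ i ∈ Finset.range n, C i, Finset.sum_nonneg fun i _ => h0 i, fun η z hz => ?_⟩
  rw [taylorRem]
  refine (abs_sub _ _).trans ?_
  gcongr
  refine (Finset.abs_sum_le_sum_abs _ _).trans ?_
  rw [mul_assoc, Finset.sum_mul]
  refine Finset.sum_le_sum fun i hi => ?_
  rw [← mul_assoc]
  exact hC i η z hz (Finset.mem_range.1 hi)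

end

/-! ### Remainders of the power expansion, regularised moments and finite parts. -/

open MeasureTheory

/-- The remainder of a power expansion after `N` terms. -/
noncomputable def powerRem (f : ℝ → ℝ) (a : ℕ → ℝ) (N : ℕ) (y : ℝ) : ℝ :=
  f y - ∑ n ∈ Finset.range N, a n / y ^ n

theorem powerRem_succ (f : ℝ → ℝ) (a : ℕ → ℝ) (N : ℕ) (y : ℝ) :
    powerRem f a (N + 1) y = powerRem f a N y - a N / y ^ N := by
  rw [powerRem, powerRem, Finset.sum_range_succ]
  ring

theorem measurable_powerRem {f : ℝ → ℝ} (hf : Continuous f) (a : ℕ → ℝ) (N : ℕ) :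
    Measurable (powerRem f a N) := by
  have := hf.measurable
  unfold powerRem
  fun_prop

/-- One bound for both ends: the strongest pole at `0` is `y ^ (-N)`, and at infinity the decay is
`y ^ (-N-1)`. -/
theorem exists_abs_powerRem_le {f : ℝ → ℝ} {a : ℕ → ℝ} (hf : Continuous f)
    (ha : HasPowerExpansion f a atTop) (N : ℕ) :
    ∃ C, 0 ≤ C ∧ ∀ y, 0 < y → |powerRem f a (N + 1) y| ≤ C * ((y ^ N)⁻¹ * (1 + y)⁻¹) := by
  obtain ⟨c, hc⟩ := (ha (N + 1)).bound
  obtain ⟨Y, hY⟩ := eventually_atTop.1 hc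
  -- Multiplication by `y ^ N` removes the poles, so compactness applies on an interval that
  -- includes `0`.
  have hcont : Continuous fun y : ℝ =>
      (1 + y) * (y ^ N * f y - ∑ n ∈ Finset.range (N + 1), a n * y ^ (N - n)) := by fun_prop
  obtain ⟨D, hD⟩ := (isCompact_Icc (a := 0) (b := max Y 1)).exists_bound_of_continuousOn
    hcont.continuousOn
  refine ⟨max D (2 * |c|), le_trans (by positivity) (le_max_right _ _), fun y hy => ?_⟩
  rcases le_total y (max Y 1) with h | h
  · have h1 := hD y ⟨hy.le, h⟩
    have h2 : y ^ N * f y - ∑ n ∈ Finset.range (N + 1), a n * y ^ (N - n)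
        = y ^ N * powerRem f a (N + 1) y := by
      rw [powerRem, mul_sub, Finset.mul_sum]
      congr 1
      refine Finset.sum_congr rfl fun n hn => ?_
      obtain ⟨d, rfl⟩ := Nat.exists_eq_add_of_le (Nat.lt_succ_iff.1 (Finset.mem_range.1 hn))
      rw [Nat.add_sub_cancel_left, pow_add]
      field_simp
    rw [h2, Real.norm_eq_abs, abs_mul, abs_mul, abs_of_pos (by positivity : 0 < 1 + y),
      abs_of_pos (by positivity : 0 < y ^ N)] at h1
    rw [← mul_inv, ← div_eq_mul_inv, le_div_iff₀ (by positivity)]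
    refine le_trans ?_ (le_max_left _ _)
    linarith
  · have h1 := hY y ((le_max_left _ _).trans h)
    have hy1 : 1 ≤ y := (le_max_right _ _).trans h
    rw [Real.norm_eq_abs, Real.norm_eq_abs,
      abs_of_pos (by positivity : 0 < (y ^ (N + 1))⁻¹)] at h1
    change |powerRem f a (N + 1) y| ≤ _ at h1
    calc |powerRem f a (N + 1) y| ≤ |c| * (y ^ (N + 1))⁻¹ :=
          h1.trans (by gcongr; exact le_abs_self c)
      _ = 2 * |c| * ((y ^ N)⁻¹ * (y + y)⁻¹) := by field_simp; ring
      _ ≤ max D (2 * |c|) * ((y ^ N)⁻¹ * (1 + y)⁻¹) := by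
          gcongr
          exact le_max_right _ _

theorem integrableOn_Ioi_sq_inv {c : ℝ} (hc : 0 < c) :
    IntegrableOn (fun z : ℝ => (z ^ 2)⁻¹) (Set.Ioi c) := by
  refine (integrableOn_Ioi_rpow_of_lt (a := -2) (by norm_num) hc).congr_fun (fun z hz => ?_)
    measurableSet_Ioi
  have hz0 : 0 < z := hc.trans hz
  simp only
  rw [Real.rpow_neg hz0.le]
  norm_num

theorem integral_Ioi_sq_inv {c : ℝ} (hc : 0 < c) : ∫ z in Set.Ioi c, (z ^ 2)⁻¹ = c⁻¹ := by
  have h := integral_Ioi_rpow_of_lt (a := -2) (by norm_num) hc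
  rw [setIntegral_congr_fun (g := fun z : ℝ => z ^ (-2 : ℝ)) measurableSet_Ioi, h]
  · norm_num
    rw [Real.rpow_neg_one]
  · intro z hz
    have hz0 : 0 < z := hc.trans hz
    simp only
    rw [Real.rpow_neg hz0.le]
    norm_num

theorem integrableOn_Ioi_of_abs_le {F : ℝ → ℝ} {c C : ℝ} (hc : 0 < c) (hF : Measurable F)
    (h1 : ∀ z, 0 < z → z ≤ c → |F z| ≤ C) (h2 : ∀ z, c < z → |F z| ≤ C * (z ^ 2)⁻¹) :
    IntegrableOn F (Set.Ioi 0) := by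
  rw [← Set.Ioc_union_Ioi_eq_Ioi hc.le, integrableOn_union]
  constructor
  · exact Measure.integrableOn_of_bounded (M := C) measure_Ioc_lt_top.ne hF.aestronglyMeasurable
      ((ae_restrict_iff' measurableSet_Ioc).2 (Eventually.of_forall fun z hz => h1 z hz.1 hz.2))
  · exact ((integrableOn_Ioi_sq_inv hc).const_mul C).mono' hF.aestronglyMeasurable
      ((ae_restrict_iff' measurableSet_Ioi).2 (Eventually.of_forall fun z hz => h2 z hz))

/-- The integrand of the `k`-th regularised moment of `f`. -/
noncomputable def momentIntegrand (f : ℝ → ℝ) (a : ℕ → ℝ) (k : ℕ) (y : ℝ) : ℝ :=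
  y ^ k * if y ≤ 1 then powerRem f a (k + 1) y else powerRem f a (k + 2) y

theorem integrableOn_momentIntegrand {f : ℝ → ℝ} {a : ℕ → ℝ} (hf : Continuous f)
    (ha : HasPowerExpansion f a atTop) (k : ℕ) :
    IntegrableOn (momentIntegrand f a k) (Set.Ioi 0) := by
  obtain ⟨C, hC0, hC⟩ := exists_abs_powerRem_le hf ha k
  obtain ⟨D, hD0, hD⟩ := exists_abs_powerRem_le hf ha (k + 1)
  refine integrableOn_Ioi_of_abs_le (c := 1) (C := max C D) one_pos ?_ ?_ ?_
  · exact (measurable_id.pow_const k).mul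
      (Measurable.ite measurableSet_Iic (measurable_powerRem hf a _) (measurable_powerRem hf a _))
  · intro z hz hz1
    rw [momentIntegrand, if_pos hz1, abs_mul, abs_of_pos (by positivity : 0 < z ^ k)]
    calc z ^ k * |powerRem f a (k + 1) z| ≤ z ^ k * (C * ((z ^ k)⁻¹ * (1 + 0)⁻¹)) := by
          gcongr
          refine (hC z hz).trans ?_
          gcongr
      _ = C := by field_simp; ring
      _ ≤ _ := le_max_left _ _
  · intro z hz
    have hz0 : 0 < z := one_pos.trans hz
    rw [momentIntegrand, if_neg hz.not_ge, abs_mul, abs_of_pos (by positivity : 0 < z ^ k)]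
    calc z ^ k * |powerRem f a (k + 2) z| ≤ z ^ k * (D * ((z ^ (k + 1))⁻¹ * (0 + z)⁻¹)) := by
          gcongr
          refine (hD z hz0).trans ?_
          gcongr
          exact zero_le_one
      _ = D * (z ^ 2)⁻¹ := by field_simp; ring
      _ ≤ _ := by gcongr; exact le_max_right _ _

/-- The difference of two cut-offs of `1 / z` at `1` and at `1 / σ`. -/
noncomputable def cutoffDiff (σ z : ℝ) : ℝ :=
  z⁻¹ * ((if z ≤ 1 then 1 else 0) - if σ * z ≤ 1 then 1 else 0)

theorem cutoffDiff_of_one_le {σ : ℝ} (hσ : 1 ≤ σ) (z : ℝ) :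
    cutoffDiff σ z = (Set.Ioc σ⁻¹ 1).indicator (fun z => z⁻¹) z := by
  have hσ0 : 0 < σ := one_pos.trans_le hσ
  have h : σ * z ≤ 1 ↔ z ≤ σ⁻¹ := by rw [← one_div, le_div_iff₀ hσ0, mul_comm]
  rw [cutoffDiff, Set.indicator_apply]
  simp only [h, Set.mem_Ioc]
  by_cases h1 : z ≤ 1 <;> by_cases h2 : z ≤ σ⁻¹
  · simp [h1, h2, not_lt.2 h2]
  · simp [h1, h2, not_le.1 h2]
  · exact absurd (h2.trans (inv_le_one_of_one_le₀ hσ)) h1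
  · simp [h1, h2]

theorem cutoffDiff_of_le_one {σ : ℝ} (hσ0 : 0 < σ) (hσ : σ ≤ 1) (z : ℝ) :
    cutoffDiff σ z = (Set.Ioc 1 σ⁻¹).indicator (fun z => -z⁻¹) z := by
  have h : σ * z ≤ 1 ↔ z ≤ σ⁻¹ := by rw [← one_div, le_div_iff₀ hσ0, mul_comm]
  rw [cutoffDiff, Set.indicator_apply]
  simp only [h, Set.mem_Ioc]
  by_cases h1 : z ≤ 1 <;> by_cases h2 : z ≤ σ⁻¹
  · simp [h1, h2, not_lt.2 h1]
  · exact absurd (h1.trans ((one_le_inv₀ hσ0).2 hσ)) h2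
  · simp [h1, h2, not_le.1 h1]
  · simp [h1, h2]

theorem integrableOn_inv_Ioc {c : ℝ} (hc : 0 < c) (d : ℝ) :
    IntegrableOn (fun z : ℝ => z⁻¹) (Set.Ioc c d) :=
  ((continuousOn_inv₀.mono fun _ hz => (hc.trans_le hz.1).ne').integrableOn_Icc).mono_set
    Set.Ioc_subset_Icc_self

theorem integrableOn_cutoffDiff {σ : ℝ} (hσ : 0 < σ) :
    IntegrableOn (cutoffDiff σ) (Set.Ioi 0) := by
  rcases le_total 1 σ with h | h
  · refine IntegrableOn.congr_fun ?_ (fun z _ => (cutoffDiff_of_one_le h z).symm)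
      measurableSet_Ioi
    exact ((integrable_indicator_iff measurableSet_Ioc).2
      (integrableOn_inv_Ioc (inv_pos.2 hσ) _)).integrableOn
  · refine IntegrableOn.congr_fun ?_ (fun z _ => (cutoffDiff_of_le_one hσ h z).symm)
      measurableSet_Ioi
    exact ((integrable_indicator_iff measurableSet_Ioc).2
      (integrableOn_inv_Ioc one_pos _).neg).integrableOn

/-- This is where the logarithm arises: the integrand is `±1 / z` between `σ⁻¹` and `1`. -/
theorem integral_cutoffDiff {σ : ℝ} (hσ : 0 < σ) :
    ∫ z in Set.Ioi 0, cutoffDiff σ z = Real.log σ := by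
  rcases le_total 1 σ with h | h
  · have hsub : Set.Ioc σ⁻¹ 1 ⊆ Set.Ioi 0 := fun z hz => (inv_pos.2 hσ).trans hz.1
    rw [setIntegral_congr_fun measurableSet_Ioi (fun z _ => cutoffDiff_of_one_le h z),
      setIntegral_indicator measurableSet_Ioc,
      Set.inter_eq_right.2 hsub,
      ← intervalIntegral.integral_of_le (inv_le_one_of_one_le₀ h),
      integral_inv_of_pos (inv_pos.2 hσ) one_pos]
    simp
  · have hsub : Set.Ioc 1 σ⁻¹ ⊆ Set.Ioi 0 := fun z hz => one_pos.trans hz.1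
    rw [setIntegral_congr_fun measurableSet_Ioi (fun z _ => cutoffDiff_of_le_one hσ h z),
      setIntegral_indicator measurableSet_Ioc,
      Set.inter_eq_right.2 hsub, integral_neg,
      ← intervalIntegral.integral_of_le ((one_le_inv₀ hσ).2 h),
      integral_inv_of_pos one_pos (inv_pos.2 hσ)]
    simp

section
variable {g : ℕ → ℝ → ℝ}

theorem exists_abs_mul_le (hg : IsRapidDerivSeq g) (j : ℕ) :
    ∃ C, 0 ≤ C ∧ ∀ η z, 0 < z → |g j (η - z)| ≤ C * (1 + |η|) * z⁻¹ := by
  obtain ⟨C, hC0, hC⟩ := hg.exists_abs_le j 1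
  refine ⟨C, hC0, fun η z hz => (hC _).trans ?_⟩
  rw [mul_assoc, pow_one]
  gcongr
  rw [← div_eq_mul_inv, le_div_iff₀ hz, inv_mul_le_iff₀ (by positivity)]
  have h1 : z ≤ |η| + |η - z| := by
    have := abs_sub η (η - z)
    rwa [sub_sub_cancel, abs_of_pos hz] at this
  nlinarith [abs_nonneg η, abs_nonneg (η - z)]

/-- Gives domination for the finite parts at infinity. The growth in `η` is harmless, because
differentiation under the integral needs only local uniformity. -/
theorem exists_abs_taylorRem_le_mul (hg : IsRapidDerivSeq g) (j n : ℕ) :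
    ∃ C, 0 ≤ C ∧ ∀ η z, 0 < z → |taylorRem g j n η z| ≤ C * (1 + |η|) * (z ^ n * z⁻¹) := by
  obtain ⟨C, hC0, hC⟩ := exists_abs_taylorRem_le hg j n
  obtain ⟨D, hD0, hD⟩ := exists_abs_taylorRem_le_of_ge hg j n
  obtain ⟨E, hE0, hE⟩ := exists_abs_mul_le hg j
  refine ⟨C + (E + D), by positivity, fun η z hz => ?_⟩
  have hη : 0 ≤ |η| := abs_nonneg η
  rw [add_mul, add_mul]
  rcases le_total z (1 + |η|) with h | h
  · refine (hC η z hz.le).trans (le_add_of_le_of_nonneg ?_ (by positivity))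
    calc C * z ^ n = C * z * (z ^ n * z⁻¹) := by field_simp
      _ ≤ _ := by gcongr
  · refine (hD η z (by linarith)).trans (le_add_of_nonneg_of_le (by positivity) ?_)
    rw [add_mul, add_mul]
    refine add_le_add ((hE η z hz).trans ?_) ?_
    · gcongr
      refine le_mul_of_one_le_left (by positivity) (one_le_pow₀ (by linarith))
    · gcongr
      exact (inv_le_one_of_one_le₀ (one_le_pow₀ (by linarith))).trans (by linarith)

/-- The integrand of the regularised integral of `g j (η - z) / z ^ (k + 1)` over `z > 0`. -/
noncomputable def singIntegrand (g : ℕ → ℝ → ℝ) (k : ℕ) (σ : ℝ) (j : ℕ) (η z : ℝ) : ℝ :=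
  (if σ * z ≤ 1 then taylorRem g j (k + 1) η z else taylorRem g j k η z) / z ^ (k + 1)

theorem exists_abs_singIntegrand_le (hg : IsRapidDerivSeq g) (k j : ℕ) :
    ∃ C, 0 ≤ C ∧ ∀ η z, 0 < z → |singIntegrand g k 1 j η z|
      ≤ C * (1 + |η|) * if z ≤ 1 then 1 else (z ^ 2)⁻¹ := by
  obtain ⟨C, hC0, hC⟩ := exists_abs_taylorRem_le hg j (k + 1)
  obtain ⟨D, hD0, hD⟩ := exists_abs_taylorRem_le_mul hg j k
  refine ⟨C + D, by positivity, fun η z hz => ?_⟩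
  have hη : 0 ≤ |η| := abs_nonneg η
  rw [singIntegrand, one_mul, abs_div, abs_of_pos (by positivity : 0 < z ^ (k + 1)),
    div_le_iff₀ (by positivity), add_mul, add_mul]
  split_ifs with h
  · calc _ ≤ C * z ^ (k + 1) := hC η z hz.le
      _ ≤ C * (1 + |η|) * 1 * z ^ (k + 1) := by
        gcongr
        nlinarith
      _ ≤ _ := by
        gcongr
        exact le_add_of_nonneg_right (by positivity)
  · calc _ ≤ D * (1 + |η|) * (z ^ k * z⁻¹) := hD η z hz
      _ = D * (1 + |η|) * (z ^ 2)⁻¹ * z ^ (k + 1) := by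
        field_simp
        ring
      _ ≤ _ := by
        gcongr
        exact le_add_of_nonneg_left (by positivity)

theorem measurable_singIntegrand (hg : IsRapidDerivSeq g) (k : ℕ) (σ : ℝ) (j : ℕ) (η : ℝ) :
    Measurable (singIntegrand g k σ j η) :=
  (Measurable.ite (measurableSet_le (by fun_prop) (by fun_prop))
    (continuous_taylorRem hg j _ η).measurable
    (continuous_taylorRem hg j _ η).measurable).div (by fun_prop)

theorem integrableOn_ite_sq_inv :
    IntegrableOn (fun z : ℝ => if z ≤ 1 then 1 else (z ^ 2)⁻¹) (Set.Ioi 0) := by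
  refine integrableOn_Ioi_of_abs_le (c := 1) (C := 1) one_pos ?_ ?_ ?_
  · exact Measurable.ite measurableSet_Iic (by fun_prop) (by fun_prop)
  · intro z _ hz
    simp [hz]
  · intro z hz
    rw [if_neg hz.not_ge, one_mul, abs_of_nonneg (by positivity)]

theorem integrableOn_singIntegrand_one (hg : IsRapidDerivSeq g) (k j : ℕ) (η : ℝ) :
    IntegrableOn (singIntegrand g k 1 j η) (Set.Ioi 0) := by
  obtain ⟨C, -, hC⟩ := exists_abs_singIntegrand_le hg k j
  exact (integrableOn_ite_sq_inv.const_mul (C * (1 + |η|))).mono'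
    (measurable_singIntegrand hg k 1 j η).aestronglyMeasurable
    ((ae_restrict_iff' measurableSet_Ioi).2 (Eventually.of_forall fun z hz => hC η z hz))

theorem hasDerivAt_singIntegrand (hg : IsRapidDerivSeq g) (k : ℕ) (σ : ℝ) (j : ℕ) (η z : ℝ) :
    HasDerivAt (fun η => singIntegrand g k σ j η z) (singIntegrand g k σ (j + 1) η z) η := by
  unfold singIntegrand
  split_ifs
  · exact (hasDerivAt_taylorRem_left hg.hasDerivAt j _ η z).div_const _
  · exact (hasDerivAt_taylorRem_left hg.hasDerivAt j _ η z).div_const _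

/-- The Hadamard regularisation of the integral of `g j (η - z) / z ^ (k + 1)` over `z > 0`. -/
noncomputable def singIntegral (g : ℕ → ℝ → ℝ) (k j : ℕ) (η : ℝ) : ℝ :=
  ∫ z in Set.Ioi 0, singIntegrand g k 1 j η z

theorem hasDerivAt_singIntegral (hg : IsRapidDerivSeq g) (k j : ℕ) (η : ℝ) :
    HasDerivAt (singIntegral g k j) (singIntegral g k (j + 1) η) η := by
  obtain ⟨C, hC0, hC⟩ := exists_abs_singIntegrand_le hg k (j + 1)
  refine (hasDerivAt_integral_of_dominated_loc_of_deriv_le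
    (bound := fun z => C * (1 + (|η| + 1)) * if z ≤ 1 then 1 else (z ^ 2)⁻¹)
    (Metric.ball_mem_nhds η one_pos)
    (Eventually.of_forall fun η => (measurable_singIntegrand hg k 1 j η).aestronglyMeasurable)
    (integrableOn_singIntegrand_one hg k j η)
    (measurable_singIntegrand hg k 1 (j + 1) η).aestronglyMeasurable ?_
    (integrableOn_ite_sq_inv.const_mul _) ?_).2
  · refine (ae_restrict_iff' measurableSet_Ioi).2 (Eventually.of_forall fun z hz y hy => ?_)
    refine (hC y z hz).trans ?_
    have hz0 : 0 < z := hz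
    rw [Metric.mem_ball, Real.dist_eq] at hy
    have := abs_sub_abs_le_abs_sub y η
    have hnn : (0 : ℝ) ≤ if z ≤ 1 then 1 else (z ^ 2)⁻¹ := by
      split_ifs <;> positivity
    gcongr
    linarith
  · exact Eventually.of_forall fun z y _ => hasDerivAt_singIntegrand hg k 1 j y z

theorem contDiff_singIntegral (hg : IsRapidDerivSeq g) (k : ℕ) :
    ContDiff ℝ ∞ (singIntegral g k 0) :=
  contDiff_of_hasDerivAt_seq (hasDerivAt_singIntegral hg k) 0

/-- The two remainders differ by one Taylor term in `z ^ k`, which becomes a multiple of `1 / z`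
after the division; moving the cut-off therefore adds a multiple of `cutoffDiff`. -/
theorem singIntegrand_eq (k : ℕ) (σ η : ℝ) {z : ℝ} (hz : 0 < z) :
    singIntegrand g k σ 0 η z
      = singIntegrand g k 1 0 η z + (-1) ^ k / (k ! : ℝ) * g k η * cutoffDiff σ z := by
  rw [singIntegrand, singIntegrand, cutoffDiff, one_mul, taylorRem_succ, zero_add]
  split_ifs <;> field_simp <;> ring

theorem integrableOn_singIntegrand (hg : IsRapidDerivSeq g) (k : ℕ) {σ : ℝ} (hσ : 0 < σ) (η : ℝ) :
    IntegrableOn (singIntegrand g k σ 0 η) (Set.Ioi 0) :=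
  ((integrableOn_singIntegrand_one hg k 0 η).add
    ((integrableOn_cutoffDiff hσ).const_mul _)).congr_fun
    (fun _ hz => (singIntegrand_eq k σ η hz).symm) measurableSet_Ioi

theorem integral_singIntegrand (hg : IsRapidDerivSeq g) (k : ℕ) {σ : ℝ} (hσ : 0 < σ) (η : ℝ) :
    ∫ z in Set.Ioi 0, singIntegrand g k σ 0 η z
      = singIntegral g k 0 η + (-1) ^ k / (k ! : ℝ) * g k η * Real.log σ := by
  rw [setIntegral_congr_fun measurableSet_Ioi (fun z hz => singIntegrand_eq k σ η hz),
    integral_add (integrableOn_singIntegrand_one hg k 0 η)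
      ((integrableOn_cutoffDiff hσ).const_mul _), integral_const_mul, integral_cutoffDiff hσ]
  rfl

/-- The regularised `k`-th moment of `f` over `y > 0`. -/
noncomputable def regMoment (f : ℝ → ℝ) (a : ℕ → ℝ) (k : ℕ) : ℝ :=
  ∫ y in Set.Ioi 0, momentIntegrand f a k y

/-- Summation by parts for `T_k R_{k+1} - T_{k+1} R_{k+2}`, in two versions. For `σ z ≤ 1` the mixed
product `T_{k+1} R_{k+1}` is inserted, for `σ z > 1` it is `T_k R_{k+2}`; with these choices both
resulting pieces are integrable separately. -/
theorem taylorRem_mul_powerRem_sub (f : ℝ → ℝ) (a : ℕ → ℝ) (k : ℕ) (η : ℝ) {σ z : ℝ}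
    (hσ : 0 < σ) (hz : 0 < z) :
    taylorRem g 0 k η z * powerRem f a (k + 1) (σ * z)
        - taylorRem g 0 (k + 1) η z * powerRem f a (k + 2) (σ * z)
      = (-1) ^ k / (k ! : ℝ) * g k η * (σ ^ k)⁻¹ * momentIntegrand f a k (σ * z)
        + a (k + 1) * (σ ^ (k + 1))⁻¹ * singIntegrand g k σ 0 η z := by
  rw [singIntegrand, momentIntegrand, taylorRem_succ, powerRem_succ f a (k + 1), zero_add]
  split_ifs <;> simp only [mul_pow] <;> field_simp <;> ring

end

/-! ### The expansion of the half-line integral. -/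

theorem integrableOn_inv_one_add_mul {σ : ℝ} (hσ : 0 < σ) (b : ℝ) :
    IntegrableOn (fun z : ℝ => (1 + σ * z)⁻¹) (Set.Ioc 0 b) := by
  refine IntegrableOn.mono_set (ContinuousOn.integrableOn_Icc ?_) Set.Ioc_subset_Icc_self
  refine ContinuousOn.inv₀ (by fun_prop) fun z hz => ?_
  have := hz.1
  positivity

theorem integral_inv_one_add_mul {σ b : ℝ} (hσ : 0 < σ) (hb : 0 ≤ b) :
    ∫ z in Set.Ioc 0 b, (1 + σ * z)⁻¹ = σ⁻¹ * Real.log (1 + σ * b) := by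
  rw [← intervalIntegral.integral_of_le hb,
    intervalIntegral.integral_eq_sub_of_hasDerivAt (f := fun z => σ⁻¹ * Real.log (1 + σ * z))]
  · simp
  · intro z hz
    rw [Set.uIcc_of_le hb] at hz
    have h1 : 0 < 1 + σ * z := by
      have := hz.1
      positivity
    have h2 : HasDerivAt (fun z => 1 + σ * z) σ z := by
      simpa using ((hasDerivAt_id z).const_mul σ).const_add 1
    refine ((h2.log h1.ne').const_mul σ⁻¹).congr_deriv ?_
    field_simp
  · rw [intervalIntegrable_iff_integrableOn_Ioc_of_le hb]
    exact integrableOn_inv_one_add_mul hσ b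

/-- Split at `z = (1 + |η|) / 2`. Below, the Taylor bound leaves the integral of `1 / (1 + σ z)`,
hence the logarithm. Above, `z ^ (-N-1)` is small enough against the total mass of `|g 0|`, and the
Taylor terms leave a tail of `z ^ (-2)`. -/
theorem exists_abs_integral_taylorRem_mul_powerRem_le {g : ℕ → ℝ → ℝ} (hg : IsRapidDerivSeq g)
    {f : ℝ → ℝ} {a : ℕ → ℝ} (hf : Continuous f) (ha : HasPowerExpansion f a atTop) (N : ℕ) :
    ∃ C, 0 ≤ C ∧ ∀ η σ, 0 < σ →
      IntegrableOn (fun z => taylorRem g 0 N η z * powerRem f a (N + 1) (σ * z)) (Set.Ioi 0) ∧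
      |∫ z in Set.Ioi 0, taylorRem g 0 N η z * powerRem f a (N + 1) (σ * z)|
        ≤ C * ((σ * (1 + |η|)) ^ (N + 1))⁻¹ * (1 + Real.log (1 + σ * (1 + |η|))) := by
  obtain ⟨C₁, h₁, hC₁⟩ := exists_abs_taylorRem_le_of_le hg 0 N
  obtain ⟨C₂, h₂, hC₂⟩ := exists_abs_taylorRem_le_of_ge hg 0 N
  obtain ⟨C₃, h₃, hC₃⟩ := exists_abs_powerRem_le hf ha N
  set G := ∫ w, |g 0 w| with hG
  have hG0 : 0 ≤ G := integral_nonneg fun w => abs_nonneg _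
  refine ⟨C₁ * C₃ + C₃ * (2 ^ (N + 1) * G + 2 * C₂), by positivity, fun η σ hσ => ?_⟩
  set ℓ := 1 + |η| with hℓ
  have hℓ0 : 0 < ℓ := by positivity
  set F := fun z => taylorRem g 0 N η z * powerRem f a (N + 1) (σ * z) with hF
  have hFm : Measurable F := (continuous_taylorRem hg 0 N η).measurable.mul
    ((measurable_powerRem hf a _).comp (measurable_const_mul σ))
  set p := fun z : ℝ => C₁ * C₃ * (ℓ ^ (N + 1))⁻¹ * (σ ^ N)⁻¹ * (1 + σ * z)⁻¹ with hp
  set q := fun z : ℝ => C₃ * (σ ^ (N + 1))⁻¹ *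
    (2 ^ (N + 1) * (ℓ ^ (N + 1))⁻¹ * |g 0 (η - z)| + C₂ * (ℓ ^ N)⁻¹ * (z ^ 2)⁻¹) with hq
  have hFp : ∀ z ∈ Set.Ioc 0 (ℓ / 2), ‖F z‖ ≤ p z := by
    intro z hz
    have hz0 : 0 < z := hz.1
    rw [Real.norm_eq_abs, abs_mul]
    calc |taylorRem g 0 N η z| * |powerRem f a (N + 1) (σ * z)|
        ≤ (C₁ * (ℓ ^ (N + 1))⁻¹ * z ^ N) * (C₃ * (((σ * z) ^ N)⁻¹ * (1 + σ * z)⁻¹)) := by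
          gcongr
          · exact hC₁ η z hz0.le hz.2
          · exact hC₃ _ (by positivity)
      _ = p z := by
          rw [hp, mul_pow]
          field_simp
  have hFq : ∀ z ∈ Set.Ioi (ℓ / 2), ‖F z‖ ≤ q z := by
    intro z hz
    have hz' : ℓ / 2 < z := hz
    have hz0 : 0 < z := lt_trans (by positivity) hz'
    have hzℓ : (z ^ (N + 1))⁻¹ ≤ 2 ^ (N + 1) * (ℓ ^ (N + 1))⁻¹ := by
      rw [← div_eq_mul_inv, ← div_pow, ← inv_pow]
      gcongr
      rw [inv_le_comm₀ hz0 (by positivity), inv_div]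
      exact hz'.le
    rw [Real.norm_eq_abs, abs_mul]
    calc |taylorRem g 0 N η z| * |powerRem f a (N + 1) (σ * z)|
        ≤ (|g 0 (η - z)| + C₂ * (ℓ ^ N)⁻¹ * (z ^ N * z⁻¹))
          * (C₃ * (((σ * z) ^ N)⁻¹ * (0 + σ * z)⁻¹)) := by
          gcongr
          · exact hC₂ η z hz'.le
          · refine (hC₃ _ (by positivity)).trans ?_
            gcongr
            exact zero_le_one
      _ = C₃ * (σ ^ (N + 1))⁻¹ *
            ((z ^ (N + 1))⁻¹ * |g 0 (η - z)| + C₂ * (ℓ ^ N)⁻¹ * (z ^ 2)⁻¹) := by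
          rw [mul_pow]
          field_simp
          ring
      _ ≤ q z := mul_le_mul_of_nonneg_left
          (add_le_add (mul_le_mul_of_nonneg_right hzℓ (abs_nonneg _)) le_rfl) (by positivity)
  have hgη : Integrable fun z => |g 0 (η - z)| := ((hg.integrable 0).comp_sub_left η).abs
  have hpi : IntegrableOn p (Set.Ioc 0 (ℓ / 2)) :=
    (integrableOn_inv_one_add_mul hσ _).const_mul _
  have hsq := integrableOn_Ioi_sq_inv (half_pos hℓ0)
  have hqi : IntegrableOn q (Set.Ioi (ℓ / 2)) :=
    ((hgη.integrableOn.const_mul _).add (hsq.const_mul _)).const_mul _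
  have hae1 := (ae_restrict_iff' (μ := volume) measurableSet_Ioc).2 (Eventually.of_forall hFp)
  have hae2 := (ae_restrict_iff' (μ := volume) measurableSet_Ioi).2 (Eventually.of_forall hFq)
  have hF1 : IntegrableOn F (Set.Ioc 0 (ℓ / 2)) := hpi.mono' hFm.aestronglyMeasurable hae1
  have hF2 : IntegrableOn F (Set.Ioi (ℓ / 2)) := hqi.mono' hFm.aestronglyMeasurable hae2
  have hunion : Set.Ioc 0 (ℓ / 2) ∪ Set.Ioi (ℓ / 2) = Set.Ioi 0 :=
    Set.Ioc_union_Ioi_eq_Ioi (by positivity)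
  refine ⟨hunion ▸ hF1.union hF2, ?_⟩
  have hlog : 0 ≤ Real.log (1 + σ * ℓ) := Real.log_nonneg (by
    have : 0 < σ * ℓ := by positivity
    linarith)
  have hI1 : ‖∫ z in Set.Ioc 0 (ℓ / 2), F z‖
      ≤ C₁ * C₃ * ((σ * ℓ) ^ (N + 1))⁻¹ * Real.log (1 + σ * ℓ) := by
    refine (norm_integral_le_of_norm_le hpi hae1).trans ?_
    rw [hp, integral_const_mul, integral_inv_one_add_mul hσ (by positivity)]
    calc _ = C₁ * C₃ * ((σ * ℓ) ^ (N + 1))⁻¹ * Real.log (1 + σ * (ℓ / 2)) := by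
          rw [mul_pow, pow_succ σ]
          field_simp
      _ ≤ _ := by
          gcongr
          linarith
  have hI2 : ‖∫ z in Set.Ioi (ℓ / 2), F z‖
      ≤ C₃ * (2 ^ (N + 1) * G + 2 * C₂) * ((σ * ℓ) ^ (N + 1))⁻¹ := by
    refine (norm_integral_le_of_norm_le hqi hae2).trans ?_
    rw [hq, integral_const_mul, integral_add (hgη.integrableOn.const_mul _) (hsq.const_mul _),
      integral_const_mul, integral_const_mul, integral_Ioi_sq_inv (half_pos hℓ0)]
    have : ∫ z in Set.Ioi (ℓ / 2), |g 0 (η - z)| ≤ G := by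
      rw [hG, ← integral_sub_left_eq_self (fun w => |g 0 w|) volume η]
      exact setIntegral_le_integral hgη (Eventually.of_forall fun z => abs_nonneg _)
    calc _ ≤ C₃ * (σ ^ (N + 1))⁻¹ *
          (2 ^ (N + 1) * (ℓ ^ (N + 1))⁻¹ * G + C₂ * (ℓ ^ N)⁻¹ * (ℓ / 2)⁻¹) := by gcongr
      _ = _ := by
          rw [mul_pow]
          field_simp
          ring
  rw [← hunion, setIntegral_union (Set.Ioc_disjoint_Ioi le_rfl) measurableSet_Ioi hF1 hF2]
  refine (norm_add_le _ _).trans ((add_le_add hI1 hI2).trans ?_)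
  have hP : 0 ≤ ((σ * ℓ) ^ (N + 1))⁻¹ := by positivity
  have e1 : 0 ≤ C₁ * C₃ * ((σ * ℓ) ^ (N + 1))⁻¹ := by positivity
  have e2 : 0 ≤ C₃ * (2 ^ (N + 1) * G + 2 * C₂) * ((σ * ℓ) ^ (N + 1))⁻¹
    * Real.log (1 + σ * ℓ) := by positivity
  nlinarith

/-- The coefficient of `σ ^ (-k - 1)` in the expansion of `∫ z > 0, g 0 (η - z) * f (σ * z)`,
without its logarithmic part. -/
noncomputable def halfLineCoeff (g : ℕ → ℝ → ℝ) (f : ℝ → ℝ) (a : ℕ → ℝ) (k : ℕ) (η : ℝ) : ℝ :=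
  (-1) ^ k / (k ! : ℝ) * regMoment f a k * g k η + a (k + 1) * singIntegral g k 0 η

theorem contDiff_halfLineCoeff {g : ℕ → ℝ → ℝ} (hg : IsRapidDerivSeq g) (f : ℝ → ℝ) (a : ℕ → ℝ)
    (k : ℕ) : ContDiff ℝ ∞ (halfLineCoeff g f a k) :=
  (contDiff_const.mul (contDiff_of_hasDerivAt_seq hg.hasDerivAt k)).add
    (contDiff_const.mul (contDiff_singIntegral hg k))

theorem integral_taylorRem_mul_powerRem_sub {g : ℕ → ℝ → ℝ} (hg : IsRapidDerivSeq g) {f : ℝ → ℝ}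
    {a : ℕ → ℝ} (hf : Continuous f) (ha : HasPowerExpansion f a atTop) (k : ℕ) (η : ℝ) {σ : ℝ}
    (hσ : 0 < σ) :
    (∫ z in Set.Ioi 0, taylorRem g 0 k η z * powerRem f a (k + 1) (σ * z))
        - ∫ z in Set.Ioi 0, taylorRem g 0 (k + 1) η z * powerRem f a (k + 2) (σ * z)
      = (σ ^ (k + 1))⁻¹ * (halfLineCoeff g f a k η
          + a (k + 1) * ((-1) ^ k / (k ! : ℝ) * g k η) * Real.log σ) := by
  obtain ⟨_, _, h1⟩ := exists_abs_integral_taylorRem_mul_powerRem_le hg hf ha k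
  obtain ⟨_, _, h2⟩ := exists_abs_integral_taylorRem_mul_powerRem_le hg hf ha (k + 1)
  have hm : IntegrableOn (fun z => momentIntegrand f a k (σ * z)) (Set.Ioi 0) := by
    rw [integrableOn_Ioi_comp_mul_left_iff _ _ hσ, mul_zero]
    exact integrableOn_momentIntegrand hf ha k
  rw [← integral_sub (h1 η σ hσ).1 (h2 η σ hσ).1, setIntegral_congr_fun measurableSet_Ioi
    (fun z hz => taylorRem_mul_powerRem_sub f a k η hσ hz),
    integral_add (hm.const_mul _) ((integrableOn_singIntegrand hg k hσ η).const_mul _),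
    integral_const_mul, integral_const_mul, integral_singIntegrand hg k hσ,
    integral_comp_mul_left_Ioi _ _ hσ, mul_zero, ← regMoment, smul_eq_mul, halfLineCoeff]
  field_simp
  ring

/-- The exact differences telescope from `I_0`, whose integrand is `g 0 (η - z) * (f (σ z) - a 0)`,
to the error `I_N`. -/
theorem exists_abs_integral_Ioi_sub_le {g : ℕ → ℝ → ℝ} (hg : IsRapidDerivSeq g) {f : ℝ → ℝ}
    {a : ℕ → ℝ} (hf : Continuous f) (ha : HasPowerExpansion f a atTop) (N : ℕ) :
    ∃ C, 0 ≤ C ∧ ∀ η σ, 0 < σ →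
      |(∫ z in Set.Ioi 0, g 0 (η - z) * f (σ * z)) - a 0 * (∫ z in Set.Ioi 0, g 0 (η - z))
          - ∑ k ∈ Finset.range N, (σ ^ (k + 1))⁻¹ * (halfLineCoeff g f a k η
            + a (k + 1) * ((-1) ^ k / (k ! : ℝ) * g k η) * Real.log σ)|
        ≤ C * ((σ * (1 + |η|)) ^ (N + 1))⁻¹ * (1 + Real.log (1 + σ * (1 + |η|))) := by
  obtain ⟨C, hC0, hC⟩ := exists_abs_integral_taylorRem_mul_powerRem_le hg hf ha N
  obtain ⟨_, _, h0⟩ := exists_abs_integral_taylorRem_mul_powerRem_le hg hf ha 0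
  refine ⟨C, hC0, fun η σ hσ => ?_⟩
  convert (hC η σ hσ).2 using 2
  rw [Finset.sum_congr rfl fun k _ => (integral_taylorRem_mul_powerRem_sub hg hf ha k η hσ).symm,
    Finset.sum_range_sub', ← integral_const_mul, sub_sub, sub_eq_iff_eq_add,
    add_comm (∫ z in Set.Ioi 0, a 0 * _), ← add_assoc, add_sub_cancel,
    ← integral_add (h0 η σ hσ).1 ((((hg.integrable 0).comp_sub_left η).integrableOn).const_mul _)]
  refine setIntegral_congr_fun measurableSet_Ioi fun z _ => ?_
  simp [taylorRem, powerRem]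
  ring

/-! ### The Poisson integral solves the Cauchy problem. -/

theorem integrable_inv_one_add_abs_sq : Integrable fun w : ℝ => ((1 + |w|) ^ 2)⁻¹ := by
  refine integrable_inv_one_add_sq.mono' (by fun_prop) (Eventually.of_forall fun w => ?_)
  rw [Real.norm_eq_abs, abs_of_nonneg (by positivity)]
  gcongr
  nlinarith [abs_nonneg w, sq_abs w]

/-- The integral of `Λ` against the function `g k`, centred at `x` and scaled by `σ`. -/
noncomputable def kernelIntegral (g : ℕ → ℝ → ℝ) (Λ : ℝ → ℝ) (k : ℕ) (x σ : ℝ) : ℝ :=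
  ∫ y, g k ((x - y) / σ) * Λ y

section
variable {g : ℕ → ℝ → ℝ} {Λ : ℝ → ℝ} {M : ℝ}

theorem integrable_majorant (x C : ℝ) {σ : ℝ} (hσ : 0 < σ) :
    Integrable fun y : ℝ => C * ((1 + |(x - y) / σ|) ^ 2)⁻¹ :=
  ((integrable_inv_one_add_abs_sq.comp_div hσ.ne').comp_sub_left x).const_mul C

/-- Lets the kernel at nearby parameters be dominated by a fixed integrable function: a small shift
or rescaling changes `1 + |w|` by at most a factor `2`. -/
theorem abs_mul_le_majorant {C w v l b : ℝ} (hb : |l| ≤ b) (h : |v| ≤ C * ((1 + |w|) ^ 2)⁻¹)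
    {w₀ : ℝ} (hw : 1 + |w₀| ≤ 2 * (1 + |w|)) : |v * l| ≤ 4 * C * b * ((1 + |w₀|) ^ 2)⁻¹ := by
  have hb0 : 0 ≤ b := (abs_nonneg _).trans hb
  have h1 : ((1 + |w|) ^ 2)⁻¹ ≤ 4 * ((1 + |w₀|) ^ 2)⁻¹ := by
    rw [← div_eq_mul_inv, inv_eq_one_div, div_le_div_iff₀ (by positivity) (by positivity)]
    nlinarith [abs_nonneg w, abs_nonneg w₀]
  have hC : 0 ≤ C := by
    by_contra hC
    have : C * ((1 + |w|) ^ 2)⁻¹ < 0 := mul_neg_of_neg_of_pos (not_le.1 hC) (by positivity)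
    linarith [abs_nonneg v]
  rw [abs_mul]
  calc |v| * |l| ≤ (C * ((1 + |w|) ^ 2)⁻¹) * b := by gcongr
    _ ≤ (C * (4 * ((1 + |w₀|) ^ 2)⁻¹)) * b := by gcongr
    _ = _ := by ring

theorem integrable_kernel (hg : IsRapidDerivSeq g) (hΛ : Continuous Λ) (hM : ∀ x, |Λ x| ≤ M)
    (k : ℕ) (x : ℝ) {σ : ℝ} (hσ : 0 < σ) : Integrable fun y => g k ((x - y) / σ) * Λ y := by
  obtain ⟨C, hC0, hC⟩ := hg.exists_abs_le k 2
  have := hg.continuous k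
  refine (integrable_majorant x (4 * C * M) hσ).mono' (by fun_prop)
    (Eventually.of_forall fun y => ?_)
  exact abs_mul_le_majorant (hM y) (hC _) (by linarith [abs_nonneg ((x - y) / σ)])

theorem hasDerivAt_kernelIntegral_space (hg : IsRapidDerivSeq g) (hΛ : Continuous Λ)
    (hM : ∀ x, |Λ x| ≤ M) (k : ℕ) (x : ℝ) {σ : ℝ} (hσ : 0 < σ) :
    HasDerivAt (fun x => kernelIntegral g Λ k x σ) (σ⁻¹ * kernelIntegral g Λ (k + 1) x σ) x := by
  obtain ⟨C, hC0, hC⟩ := hg.exists_abs_le (k + 1) 2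
  have h1 := hg.continuous k
  have h2 := hg.continuous (k + 1)
  rw [kernelIntegral, ← integral_const_mul]
  refine (hasDerivAt_integral_of_dominated_loc_of_deriv_le
    (F' := fun x y => σ⁻¹ * (g (k + 1) ((x - y) / σ) * Λ y))
    (bound := fun y => σ⁻¹ * (4 * C * M * ((1 + |(x - y) / σ|) ^ 2)⁻¹))
    (Metric.ball_mem_nhds x hσ) (Eventually.of_forall fun x => by fun_prop)
    (integrable_kernel hg hΛ hM k x hσ) (by fun_prop) ?_
    ((integrable_majorant x _ hσ).const_mul _) ?_).2
  · refine Eventually.of_forall fun y x' hx' => ?_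
    rw [Metric.mem_ball, Real.dist_eq] at hx'
    rw [norm_mul, Real.norm_eq_abs, abs_of_pos (inv_pos.2 hσ)]
    refine mul_le_mul_of_nonneg_left (abs_mul_le_majorant (hM y) (hC _) ?_) (inv_pos.2 hσ).le
    have h3 : |(x' - x) / σ| < 1 := by
      rwa [abs_div, abs_of_pos hσ, div_lt_one hσ]
    have h4 : |(x - y) / σ| ≤ |(x' - y) / σ| + |(x' - x) / σ| := by
      rw [show (x - y) / σ = (x' - y) / σ - (x' - x) / σ by ring]
      exact abs_sub _ _
    linarith [abs_nonneg ((x' - y) / σ)]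
  · refine Eventually.of_forall fun y x' _ => ?_
    have h3 : HasDerivAt (fun x => (x - y) / σ) σ⁻¹ x' := by
      simpa using ((hasDerivAt_id x').sub_const y).div_const σ
    refine (((hg.hasDerivAt k _).comp x' h3).mul_const (Λ y)).congr_deriv ?_
    ring

/-- The scale derivative of the Gaussian is `σ⁻¹ * 2 w² exp (-w²)`, and `2 w² = (4 w² - 2) / 2 + 1`
expresses it by the second and zeroth derivatives. -/
theorem hasDerivAt_kernelIntegral_scale (hΛ : Continuous Λ)
    (hM : ∀ x, |Λ x| ≤ M) (x : ℝ) {σ : ℝ} (hσ : 0 < σ) :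
    HasDerivAt (fun σ => kernelIntegral gaussDeriv Λ 0 x σ)
      (σ⁻¹ * (kernelIntegral gaussDeriv Λ 2 x σ / 2 + kernelIntegral gaussDeriv Λ 0 x σ)) σ := by
  have hg := isRapidDerivSeq_gaussDeriv
  obtain ⟨C, hC0, hC⟩ := hg.exists_abs_le 0 2
  obtain ⟨D, hD0, hD⟩ := hg.exists_abs_le 2 2
  have h1 := hg.continuous 0
  have h2 := hg.continuous 2
  have hM0 : 0 ≤ M := (abs_nonneg _).trans (hM 0)
  rw [kernelIntegral, kernelIntegral, div_eq_inv_mul, ← integral_const_mul,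
    ← integral_add ((integrable_kernel hg hΛ hM 2 x hσ).const_mul _)
      (integrable_kernel hg hΛ hM 0 x hσ), ← integral_const_mul]
  refine (hasDerivAt_integral_of_dominated_loc_of_deriv_le
    (F' := fun s y => s⁻¹ * (2⁻¹ * (gaussDeriv 2 ((x - y) / s) * Λ y)
      + gaussDeriv 0 ((x - y) / s) * Λ y))
    (bound := fun y => 2 * σ⁻¹ * (4 * (D + C) * M * ((1 + |(x - y) / σ|) ^ 2)⁻¹))
    (Metric.ball_mem_nhds σ (half_pos hσ)) (Eventually.of_forall fun s => by fun_prop)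
    (integrable_kernel hg hΛ hM 0 x hσ) (by fun_prop) ?_
    ((integrable_majorant x _ hσ).const_mul _) ?_).2
  · refine Eventually.of_forall fun y s hs => ?_
    rw [Metric.mem_ball, Real.dist_eq, abs_lt] at hs
    have hs0 : 0 < s := by linarith
    have h4 : s⁻¹ ≤ 2 * σ⁻¹ := by
      rw [← div_eq_mul_inv, inv_eq_one_div, div_le_div_iff₀ hs0 hσ]
      linarith
    have h3 : 1 + |(x - y) / σ| ≤ 2 * (1 + |(x - y) / s|) := by
      rw [abs_div, abs_div, abs_of_pos hσ, abs_of_pos hs0]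
      have : |x - y| / σ ≤ 2 * (|x - y| / s) := by
        rw [← mul_div_assoc, div_le_div_iff₀ hσ hs0]
        nlinarith [abs_nonneg (x - y)]
      linarith
    have e1 := abs_mul_le_majorant (hM y) (hC ((x - y) / s)) h3
    have e2 := abs_mul_le_majorant (hM y) (hD ((x - y) / s)) h3
    rw [norm_mul, Real.norm_eq_abs, Real.norm_eq_abs, abs_of_pos (inv_pos.2 hs0)]
    refine mul_le_mul h4 ((abs_add_le _ _).trans ?_) (abs_nonneg _) (by positivity)
    rw [abs_mul 2⁻¹, abs_of_pos (by norm_num : (0 : ℝ) < 2⁻¹)]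
    have := abs_nonneg (gaussDeriv 2 ((x - y) / s) * Λ y)
    have e3 : 4 * (D + C) * M * ((1 + |(x - y) / σ|) ^ 2)⁻¹
      = 4 * D * M * ((1 + |(x - y) / σ|) ^ 2)⁻¹ + 4 * C * M * ((1 + |(x - y) / σ|) ^ 2)⁻¹ := by
      ring
    linarith
  · refine Eventually.of_forall fun y s hs => ?_
    rw [Metric.mem_ball, Real.dist_eq, abs_lt] at hs
    have hs0 : 0 < s := by linarith
    have h3 : HasDerivAt (fun s => (x - y) / s) (-((x - y) / s ^ 2)) s := by
      refine ((hasDerivAt_inv hs0.ne').const_mul (x - y)).congr_deriv ?_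
      field_simp
    refine (((hg.hasDerivAt 0 _).comp s h3).mul_const (Λ y)).congr_deriv ?_
    rw [gaussDeriv_zero, zero_add, gaussDeriv_one, gaussDeriv_two]
    field_simp
    ring

end

theorem integral_gaussDeriv_zero : ∫ w, gaussDeriv 0 w = √π := by
  simp only [gaussDeriv_zero]
  simpa using integral_gaussian 1

/-- The solution of the heat equation given by the Poisson integral. -/
noncomputable def heatSol (Λ : ℝ → ℝ) (x t : ℝ) : ℝ :=
  (√π)⁻¹ * ∫ w, gaussDeriv 0 w * Λ (x - 2 * √t * w)

theorem heatSol_eq (Λ : ℝ → ℝ) (x : ℝ) {t : ℝ} (ht : 0 < t) :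
    heatSol Λ x t
      = (√π)⁻¹ * ((2 * √t)⁻¹ * kernelIntegral gaussDeriv Λ 0 x (2 * √t)) := by
  have hσ : 0 < 2 * √t := by positivity
  rw [heatSol, kernelIntegral,
    ← integral_sub_left_eq_self (fun y => gaussDeriv 0 ((x - y) / (2 * √t)) * Λ y) volume x,
    ← smul_eq_mul (2 * √t)⁻¹, ← abs_of_pos (inv_pos.2 hσ), ← Measure.integral_comp_mul_left]
  congr 1
  refine integral_congr_ae (Eventually.of_forall fun w => ?_)
  simp only [sub_sub_cancel]
  rw [mul_div_cancel_left₀ _ hσ.ne']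

theorem heatSol_eq_integral (Λ : ℝ → ℝ) (x : ℝ) {t : ℝ} (ht : 0 < t) :
    heatSol Λ x t = (√π)⁻¹ * ∫ z, gaussDeriv 0 (x / (2 * √t) - z) * Λ (2 * √t * z) := by
  have hσ : 0 < 2 * √t := by positivity
  rw [heatSol, ← integral_sub_left_eq_self (fun w => gaussDeriv 0 w * Λ (x - 2 * √t * w)) volume
    (x / (2 * √t))]
  congr 1
  refine integral_congr_ae (Eventually.of_forall fun z => ?_)
  simp only
  rw [show x - 2 * √t * (x / (2 * √t) - z) = 2 * √t * z by field_simp; ring]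

theorem isBoundedHeatSolution_heatSol {Λ : ℝ → ℝ} (hΛ : Continuous Λ) {M : ℝ}
    (hM : ∀ x, |Λ x| ≤ M) : IsBoundedHeatSolution Λ (heatSol Λ) := by
  have hg := isRapidDerivSeq_gaussDeriv
  have hg0 := hg.continuous 0
  have hseq : ∀ t : ℝ, 0 < t → ∀ k x, HasDerivAt
      (fun x => (√π)⁻¹ * (2 * √t)⁻¹ ^ (k + 1) * kernelIntegral gaussDeriv Λ k x (2 * √t))
      ((√π)⁻¹ * (2 * √t)⁻¹ ^ (k + 1 + 1) * kernelIntegral gaussDeriv Λ (k + 1) x (2 * √t)) x := by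
    intro t ht k x
    refine ((hasDerivAt_kernelIntegral_space hg hΛ hM k x
      (by positivity : 0 < 2 * √t)).const_mul _).congr_deriv ?_
    ring
  have heq : ∀ t : ℝ, 0 < t → (fun x => heatSol Λ x t)
      = fun x => (√π)⁻¹ * (2 * √t)⁻¹ ^ (0 + 1) * kernelIntegral gaussDeriv Λ 0 x (2 * √t) := by
    intro t ht
    funext x
    rw [heatSol_eq Λ x ht]
    ring
  refine ⟨⟨(√π)⁻¹ * ∫ w, |gaussDeriv 0 w| * M, fun x t _ => ?_⟩, ?_, fun t ht => ?_,
    fun x t ht => ?_, fun x => ?_⟩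
  · rw [heatSol, abs_mul, abs_of_pos (by positivity)]
    gcongr
    rw [← Real.norm_eq_abs]
    refine norm_integral_le_of_norm_le ((hg.integrable 0).abs.mul_const M)
      (Eventually.of_forall fun w => ?_)
    rw [Real.norm_eq_abs, abs_mul]
    gcongr
    exact hM _
  -- In the form with fixed Gaussian weight the integrand is continuous in `(x, t)` on the whole
  -- plane, as `√t` is, so `t = 0` needs no separate limit.
  · refine Continuous.continuousOn ?_
    unfold heatSol
    refine continuous_const.mul (continuous_of_dominated (bound := fun w => |gaussDeriv 0 w| * M)
      (fun p => by fun_prop) (fun p => Eventually.of_forall fun w => ?_)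
      ((hg.integrable 0).abs.mul_const M) (Eventually.of_forall fun w => by fun_prop))
    rw [Real.norm_eq_abs, abs_mul]
    gcongr
    exact hM _
  · rw [heq t ht]
    exact contDiff_infty.1 (contDiff_of_hasDerivAt_seq (hseq t ht) 0) 2
  · have h2 : iteratedDeriv 2 (fun y => heatSol Λ y t) x
        = (√π)⁻¹ * (2 * √t)⁻¹ ^ 3 * kernelIntegral gaussDeriv Λ 2 x (2 * √t) := by
      rw [heq t ht, iteratedDeriv_succ, iteratedDeriv_one,
        show deriv _ = _ from funext fun y => (hseq t ht 0 y).deriv]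
      exact (hseq t ht 1 x).deriv
    have hσ : 0 < 2 * √t := by positivity
    have h3 : HasDerivAt (fun s => 2 * √s) (√t)⁻¹ t := by
      refine ((Real.hasDerivAt_sqrt ht.ne').const_mul 2).congr_deriv ?_
      field_simp
    -- The derivative of the prefactor `σ⁻¹` cancels the zeroth-order term, leaving `σ⁻² K₂ / 2`;
    -- with `dσ/dt = 2 / σ` this is `σ⁻³ K₂`, the second space derivative.
    have h4 := (hasDerivAt_inv hσ.ne').mul (hasDerivAt_kernelIntegral_scale hΛ hM x hσ)
    have h5 := (h4.comp t h3).const_mul (√π)⁻¹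
    rw [h2]
    refine (h5.congr_of_eventuallyEq ?_).congr_deriv ?_
    · filter_upwards [eventually_gt_nhds ht] with s hs
      rw [heatSol_eq Λ x hs]
      rfl
    · field_simp
      ring
  · rw [heatSol]
    simp only [Real.sqrt_zero, mul_zero, zero_mul, sub_zero, integral_mul_const]
    rw [integral_gaussDeriv_zero, inv_mul_cancel_left₀ (by positivity)]

/-! ### Maximum principle and uniqueness. -/

theorem IsLocalMax.deriv_deriv_nonpos {f : ℝ → ℝ} {x : ℝ} (h : IsLocalMax f x)
    (hf : ContinuousAt f x) : deriv (deriv f) x ≤ 0 := by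
  by_contra! hpos
  -- A point that is both a local maximum and a local minimum makes `f` locally constant.
  have hmin := isLocalMin_of_deriv_deriv_pos hpos h.deriv_eq_zero hf
  have hconst : f =ᶠ[nhds x] fun _ => f x := by
    filter_upwards [h, hmin] with y h1 h2
    exact le_antisymm h1 h2
  have : deriv (deriv f) x = 0 := by
    rw [hconst.deriv.deriv_eq]
    simp
  linarith

theorem HasDerivAt.nonneg_of_forall_le {f : ℝ → ℝ} {f' b t : ℝ} (h : HasDerivAt f f' t) (hb : b < t)
    (hle : ∀ s, b < s → s < t → f s ≤ f t) : 0 ≤ f' := by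
  have h1 := (hasDerivWithinAt_iff_tendsto_slope' (s := Set.Iio t) (lt_irrefl t)).1
    h.hasDerivWithinAt
  refine ge_of_tendsto h1 ?_
  filter_upwards [Ioo_mem_nhdsLT hb] with s hs
  rw [slope_def_field]
  exact div_nonneg_of_nonpos (by linarith [hle s hs.1 hs.2]) (by linarith [hs.2])

namespace IsBoundedHeatSolution

theorem sub {Λ₁ Λ₂ : ℝ → ℝ} {u v : ℝ → ℝ → ℝ} (hu : IsBoundedHeatSolution Λ₁ u)
    (hv : IsBoundedHeatSolution Λ₂ v) :
    IsBoundedHeatSolution (fun x => Λ₁ x - Λ₂ x) (fun x t => u x t - v x t) where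
  bounded := by
    obtain ⟨C, hC⟩ := hu.bounded
    obtain ⟨D, hD⟩ := hv.bounded
    exact ⟨C + D, fun x t ht => (abs_sub _ _).trans (add_le_add (hC x t ht) (hD x t ht))⟩
  continuousOn := hu.continuousOn.sub hv.continuousOn
  contDiff_space t ht := (hu.contDiff_space t ht).sub (hv.contDiff_space t ht)
  heat_eq x t ht := by
    refine ((hu.heat_eq x t ht).sub (hv.heat_eq x t ht)).congr_deriv ?_
    exact (iteratedDeriv_fun_sub (hu.contDiff_space t ht).contDiffAt
      (hv.contDiff_space t ht).contDiffAt).symm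
  initial x := by rw [hu.initial, hv.initial]

/-- Subtract the barrier `ε (x² + 3t)`. Its time derivative `3ε` strictly exceeds its second space
derivative `2ε`, so no maximum lies off the parabolic boundary; then let `ε → 0`. -/
theorem nonpos_of_initial_zero {w : ℝ → ℝ → ℝ} (hw : IsBoundedHeatSolution (fun _ => 0) w)
    (x₀ t₀ : ℝ) (ht₀ : 0 < t₀) : w x₀ t₀ ≤ 0 := by
  obtain ⟨M, hM⟩ := hw.bounded
  have key : ∀ ε : ℝ, 0 < ε → w x₀ t₀ ≤ ε * (x₀ ^ 2 + 3 * t₀) := by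
    intro ε hε
    -- The box contains `x₀`, and on its lateral sides the barrier is at least `M`.
    set X := max |x₀| (√(M / ε)) with hX
    have hX0 : 0 ≤ X := (abs_nonneg _).trans (le_max_left _ _)
    have hXM : M ≤ ε * X ^ 2 := by
      have h1 : M / ε ≤ X ^ 2 := (Real.sqrt_le_left hX0).1 (le_max_right _ _)
      rwa [div_le_iff₀' hε] at h1
    have hcont : ContinuousOn (fun p : ℝ × ℝ => w p.1 p.2 - ε * (p.1 ^ 2 + 3 * p.2))
        (Set.Icc (-X) X ×ˢ Set.Icc 0 t₀) :=
      (hw.continuousOn.mono fun p hp => hp.2.1).sub (by fun_prop)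
    have hmem₀ : (x₀, t₀) ∈ Set.Icc (-X) X ×ˢ Set.Icc 0 t₀ :=
      ⟨abs_le.1 (le_max_left _ _), ht₀.le, le_rfl⟩
    obtain ⟨⟨x, t⟩, ⟨hx, ht⟩, hmax⟩ :=
      (isCompact_Icc.prod isCompact_Icc).exists_isMaxOn ⟨_, hmem₀⟩ hcont
    rw [isMaxOn_iff] at hmax
    simp only at hx ht
    suffices h : w x t - ε * (x ^ 2 + 3 * t) ≤ 0 by
      have := hmax _ hmem₀
      simp only at this
      linarith
    rcases ht.1.eq_or_lt with h0 | h0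
    · rw [← h0, hw.initial]
      have : 0 ≤ ε * (x ^ 2 + 3 * 0) := by positivity
      linarith
    by_cases hxX : |x| = X
    · have h1 := (le_abs_self _).trans (hM x t ht.1)
      have h2 : X ^ 2 = x ^ 2 := by rw [← hxX, sq_abs]
      rw [h2] at hXM
      nlinarith
    · exfalso
      have hxlt : |x| < X := lt_of_le_of_ne (abs_le.2 hx) hxX
      have htime : 0 ≤ iteratedDeriv 2 (fun y => w y t) x - ε * 3 := by
        have hd : HasDerivAt (fun s => w x s - ε * (x ^ 2 + 3 * s))
            (iteratedDeriv 2 (fun y => w y t) x - ε * 3) t := by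
          refine (hw.heat_eq x t h0).sub ?_
          simpa using (((hasDerivAt_id t).const_mul 3).const_add (x ^ 2)).const_mul ε
        -- Only earlier times are compared, so the top edge `t = t₀` is covered.
        refine hd.nonneg_of_forall_le h0 fun s hs0 hst => ?_
        exact hmax (x, s) ⟨hx, hs0.le, hst.le.trans ht.2⟩
      have hspace : iteratedDeriv 2 (fun y => w y t) x - ε * 2 ≤ 0 := by
        have hC2 := hw.contDiff_space t h0
        have hd1 : ∀ y, HasDerivAt (fun y => w y t - ε * (y ^ 2 + 3 * t))
            (deriv (fun y => w y t) y - ε * (2 * y)) y := by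
          intro y
          refine ((hC2.differentiable (by norm_num)) y).hasDerivAt.sub ?_
          simpa using ((hasDerivAt_pow 2 y).add_const (3 * t)).const_mul ε
        have hmax' : IsLocalMax (fun y => w y t - ε * (y ^ 2 + 3 * t)) x := by
          filter_upwards [Ioo_mem_nhds (abs_lt.1 hxlt).1 (abs_lt.1 hxlt).2] with y hy
          exact hmax (y, t) ⟨⟨hy.1.le, hy.2.le⟩, ht⟩
        have h2 := hmax'.deriv_deriv_nonpos (hd1 x).continuousAt
        have hdd : HasDerivAt (fun y => deriv (fun y => w y t) y - ε * (2 * y))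
            (iteratedDeriv 2 (fun y => w y t) x - ε * 2) x := by
          rw [iteratedDeriv_succ, iteratedDeriv_one]
          refine HasDerivAt.sub ?_ ?_
          · have hC1 : ContDiff ℝ 1 (deriv fun y => w y t) :=
              ((contDiff_succ_iff_deriv (F := ℝ) (n := 1)).1 hC2).2.2
            exact (hC1.differentiable (by norm_num) x).hasDerivAt
          · simpa using ((hasDerivAt_id x).const_mul 2).const_mul ε
        rwa [show deriv (fun y => w y t - ε * (y ^ 2 + 3 * t)) = _ from
          funext fun y => (hd1 y).deriv, hdd.deriv] at h2
      linarith
  refine le_of_forall_pos_le_add fun δ hδ => ?_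
  have hK : 0 < x₀ ^ 2 + 3 * t₀ := by positivity
  have := key (δ / (x₀ ^ 2 + 3 * t₀)) (by positivity)
  rw [div_mul_cancel₀ _ hK.ne'] at this
  linarith

theorem eq_of_pos {Λ : ℝ → ℝ} {u v : ℝ → ℝ → ℝ} (hu : IsBoundedHeatSolution Λ u)
    (hv : IsBoundedHeatSolution Λ v) (x t : ℝ) (ht : 0 < t) : u x t = v x t := by
  have h1 := (hu.sub hv)
  have h2 := (hv.sub hu)
  simp only [sub_self] at h1 h2
  have h3 := h1.nonpos_of_initial_zero x t ht
  have h4 := h2.nonpos_of_initial_zero x t ht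
  linarith

end IsBoundedHeatSolution

/-! ### Joining the two half-lines. -/

theorem HasPowerExpansion.comp_neg {f : ℝ → ℝ} {a : ℕ → ℝ} (h : HasPowerExpansion f a atBot) :
    HasPowerExpansion (fun y => f (-y)) (fun n => (-1) ^ n * a n) atTop := by
  intro N
  have h1 := (h N).comp_tendsto tendsto_neg_atTop_atBot
  refine IsBigO.congr_left (h1.trans (IsBigO.of_bound' (Eventually.of_forall fun y => ?_)))
    fun y => ?_
  · simp
  · simp only [Function.comp]
    congr 1
    refine Finset.sum_congr rfl fun n _ => ?_
    rw [neg_pow y n, mul_comm ((-1) ^ n) (a n), div_mul_eq_div_div_swap, mul_div_right_comm]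
    rcases neg_one_pow_eq_or ℝ n with h | h <;> simp [h, div_neg]

theorem hermiteFun_neg (j : ℕ) (η : ℝ) : hermiteFun j (-η) = (-1) ^ j * hermiteFun j η := by
  rw [hermiteFun, hermiteFun, Finset.mul_sum]
  refine Finset.sum_congr rfl fun k hk => ?_
  rw [Finset.mem_range] at hk
  obtain ⟨d, rfl⟩ := Nat.exists_eq_add_of_le (show 2 * k ≤ j by omega)
  rw [Nat.add_sub_cancel_left, neg_sq, neg_pow η d, pow_add (-1 : ℝ), pow_mul, neg_one_sq, one_pow]
  ring

theorem gaussDeriv_coeff (k : ℕ) (η : ℝ) :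
    (-1) ^ k / (k ! : ℝ) * gaussDeriv k η = 2 ^ k * hermiteFun k η := by
  have : (k ! : ℝ) ≠ 0 := by positivity
  rw [gaussDeriv, show (-2 : ℝ) ^ k = (-1) ^ k * 2 ^ k by rw [← mul_pow]; norm_num]
  field_simp
  rw [← pow_mul, pow_mul', neg_one_sq, one_pow, one_mul]

theorem integral_Ioi_gaussDeriv_zero (η : ℝ) :
    ∫ z in Set.Ioi 0, gaussDeriv 0 (η - z) = √π * erfc (-η) := by
  rw [erfc, ← mul_assoc, mul_one_div_cancel (by positivity), one_mul,
    ← integral_indicator measurableSet_Ioi, ← integral_indicator measurableSet_Ioi,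
    ← integral_sub_right_eq_self ((Set.Ioi (-η)).indicator fun s => Real.exp (-s ^ 2)) η]
  refine integral_congr_ae (Eventually.of_forall fun z => ?_)
  have h : -η < z - η ↔ 0 < z := by constructor <;> intro _ <;> linarith
  simp only [Set.indicator_apply, Set.mem_Ioi, gaussDeriv_zero, h,
    show (η - z) ^ 2 = (z - η) ^ 2 by ring]

theorem heatSol_eq_add (Λ : ℝ → ℝ) (hΛ : Continuous Λ) {M : ℝ} (hM : ∀ x, |Λ x| ≤ M) (x : ℝ)
    {t : ℝ} (ht : 0 < t) :
    heatSol Λ x t = (√π)⁻¹ *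
      ((∫ z in Set.Ioi 0, gaussDeriv 0 (x / (2 * √t) - z) * Λ (2 * √t * z))
        + ∫ z in Set.Ioi 0, gaussDeriv 0 (-(x / (2 * √t)) - z) * Λ (-(2 * √t * z))) := by
  have hg := isRapidDerivSeq_gaussDeriv
  have hc := hg.continuous 0
  have hint : Integrable fun z => gaussDeriv 0 (x / (2 * √t) - z) * Λ (2 * √t * z) := by
    refine (((hg.integrable 0).comp_sub_left (x / (2 * √t))).abs.mul_const M).mono'
      (by fun_prop) (Eventually.of_forall fun z => ?_)
    rw [Real.norm_eq_abs, abs_mul]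
    gcongr
    exact hM _
  rw [heatSol_eq_integral Λ x ht,
    ← intervalIntegral.integral_Iic_add_Ioi (b := 0) hint.integrableOn hint.integrableOn,
    add_comm, ← neg_zero, ← integral_comp_neg_Ioi, neg_zero]
  congr 2
  refine setIntegral_congr_fun measurableSet_Ioi fun z _ => ?_
  simp only [gaussDeriv_zero]
  rw [show (x / (2 * √t) - -z) ^ 2 = (-(x / (2 * √t)) - z) ^ 2 by ring, mul_neg]

/-- The part without logarithm of the coefficient of `t ^ (-n / 2)` in the expansion. -/
noncomputable def heatCoeff (Λ : ℝ → ℝ) (Λp Λm : ℕ → ℝ) (n : ℕ) (η : ℝ) : ℝ :=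
  (√π)⁻¹ * (2 ^ n)⁻¹ *
    ((halfLineCoeff gaussDeriv Λ Λp (n - 1) η
        + halfLineCoeff gaussDeriv (fun y => Λ (-y)) (fun n => (-1) ^ n * Λm n) (n - 1) (-η))
      + (Λp n - Λm n) * Real.log 2 * 2 ^ (n - 1) * hermiteFun (n - 1) η)

theorem contDiff_hermiteFun (k : ℕ) : ContDiff ℝ ∞ (hermiteFun k) := by
  have h := contDiff_of_hasDerivAt_seq isRapidDerivSeq_gaussDeriv.hasDerivAt k
  have : hermiteFun k = fun η => ((-2) ^ k * (k ! : ℝ))⁻¹ * gaussDeriv k η := by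
    funext η
    have : (-2 : ℝ) ^ k * (k ! : ℝ) ≠ 0 := by positivity
    rw [gaussDeriv, inv_mul_cancel_left₀ this]
  rw [this]
  exact contDiff_const.mul h

theorem contDiff_heatCoeff (Λ : ℝ → ℝ) (Λp Λm : ℕ → ℝ) (n : ℕ) :
    ContDiff ℝ ∞ (heatCoeff Λ Λp Λm n) :=
  contDiff_const.mul (((contDiff_halfLineCoeff isRapidDerivSeq_gaussDeriv _ _ _).add
    ((contDiff_halfLineCoeff isRapidDerivSeq_gaussDeriv _ _ _).comp contDiff_neg)).add
    (contDiff_const.mul (contDiff_hermiteFun _)))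

theorem rpow_neg_div_two {t : ℝ} (ht : 0 ≤ t) (n : ℕ) : t ^ (-(n : ℝ) / 2) = ((√t) ^ n)⁻¹ := by
  rw [Real.sqrt_eq_rpow, ← Real.rpow_natCast, ← Real.rpow_mul ht, ← Real.rpow_neg ht]
  congr 1
  ring

/-- Since `log σ = log 2 + (log t) / 2`, the `log 2` goes into `heatCoeff`. The sign `(-1) ^ (k +
1)` from reflecting `Λ` and the parity `(-1) ^ k` of the Hermite function combine to `-1`, which
produces `Λp - Λm`. -/
theorem heat_term_eq (Λ : ℝ → ℝ) (Λp Λm : ℕ → ℝ) (k : ℕ) (η : ℝ) {t : ℝ} (ht : 0 < t) :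
    t ^ (-((k + 1 : ℕ) : ℝ) / 2) * (heatCoeff Λ Λp Λm (k + 1) η
        + (Λp (k + 1) - Λm (k + 1)) / (4 * √π) * hermiteFun k η * Real.log t)
      = (√π)⁻¹ * (((2 * √t) ^ (k + 1))⁻¹ * (halfLineCoeff gaussDeriv Λ Λp k η
          + Λp (k + 1) * ((-1) ^ k / (k ! : ℝ) * gaussDeriv k η) * Real.log (2 * √t))
        + ((2 * √t) ^ (k + 1))⁻¹ *
          (halfLineCoeff gaussDeriv (fun y => Λ (-y)) (fun n => (-1) ^ n * Λm n) k (-η)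
            + (-1) ^ (k + 1) * Λm (k + 1) * ((-1) ^ k / (k ! : ℝ) * gaussDeriv k (-η))
              * Real.log (2 * √t))) := by
  have hs : 0 < √t := Real.sqrt_pos.2 ht
  have hlog : Real.log (2 * √t) = Real.log 2 + Real.log t / 2 := by
    rw [Real.log_mul two_ne_zero hs.ne', Real.log_sqrt ht.le]
  have hsign : (-1 : ℝ) ^ k * (-1) ^ k = 1 := by rw [← mul_pow]; norm_num
  rw [rpow_neg_div_two ht.le, hlog, gaussDeriv_coeff, gaussDeriv_coeff, hermiteFun_neg, heatCoeff,
    Nat.add_sub_cancel, mul_pow, pow_succ (-1 : ℝ),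
    show (-1 : ℝ) ^ k * -1 * Λm (k + 1) * (2 ^ k * ((-1) ^ k * hermiteFun k η))
      = ((-1) ^ k * (-1) ^ k) * (-Λm (k + 1) * (2 ^ k * hermiteFun k η)) by ring, hsign]
  field_simp
  ring

theorem inv_pow_mul_log_le (N : ℕ) {s q : ℝ} (hq : 3 ≤ q) (hs : 0 ≤ s) (h1 : q ≤ s ^ 2)
    (h2 : s ^ 2 ≤ 8 * q) :
    (s ^ (N + 1))⁻¹ * (1 + Real.log (1 + s)) ≤
      4 * (q ^ (-((N : ℝ) + 1) / 2) * Real.log q) := by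
  have hq0 : 0 < q := by linarith
  -- The assumption `3 ≤ q` serves to exceed `e`; additive constants can then be absorbed into `log
  -- q`, and `1 + 2 log 2 < 3` accounts for the factor `4`.
  have hlogq : 1 ≤ Real.log q := by
    rw [Real.le_log_iff_exp_le hq0]
    linarith [Real.exp_one_lt_d9]
  have h3 : 1 + s ≤ 4 * q := by nlinarith
  have h4 : Real.log (1 + s) ≤ 2 * Real.log 2 + Real.log q := by
    refine (Real.log_le_log (by positivity) h3).trans_eq ?_
    rw [Real.log_mul (by norm_num) hq0.ne', show (4 : ℝ) = 2 ^ 2 by norm_num, Real.log_pow]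
    push_cast
    ring
  have h5 : q ^ (-((N : ℝ) + 1) / 2) = ((√q) ^ (N + 1))⁻¹ := by
    rw [← rpow_neg_div_two hq0.le]
    push_cast
    rfl
  have h6 : √q ≤ s := (Real.sqrt_le_left hs).2 h1
  have h7 : 0 < √q := Real.sqrt_pos.2 hq0
  have h8 : 0 ≤ Real.log (1 + s) := Real.log_nonneg (by linarith)
  rw [h5]
  calc (s ^ (N + 1))⁻¹ * (1 + Real.log (1 + s))
      ≤ ((√q) ^ (N + 1))⁻¹ * (4 * Real.log q) := by
        gcongr
        linarith [Real.log_two_lt_d9]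
    _ = _ := by ring

theorem theorem1 (Λ : ℝ → ℝ) (hcont : Continuous Λ) (hbdd : ∃ C : ℝ, ∀ x : ℝ, |Λ x| ≤ C)
    (Λp Λm : ℕ → ℝ) (hp : HasPowerExpansion Λ Λp atTop) (hm : HasPowerExpansion Λ Λm atBot) :
    (∃ u : ℝ → ℝ → ℝ, IsBoundedHeatSolution Λ u) ∧
    ∃ H₀ H₁ : ℕ → ℝ → ℝ,
      (∀ n : ℕ, 1 ≤ n → ContDiff ℝ ∞ (H₀ n) ∧ ContDiff ℝ ∞ (H₁ n)) ∧
      (∀ n : ℕ, 1 ≤ n → ∀ η : ℝ,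
        H₁ n η = (Λp n - Λm n) / (4 * √π) * hermiteFun (n - 1) η) ∧
      ∀ u : ℝ → ℝ → ℝ, IsBoundedHeatSolution Λ u →
        ∀ N : ℕ, ∃ C R : ℝ, ∀ x t : ℝ, 0 < t → R ≤ |x| + t →
          |u x t - (Λm 0 * erfc (x / (2 * √t)) + Λp 0 * erfc (-(x / (2 * √t)))
              + ∑ n ∈ Finset.Icc 1 N, t ^ (-(n : ℝ) / 2) *
                  (H₀ n (x / (2 * √t)) + H₁ n (x / (2 * √t)) * Real.log t))|
            ≤ C * (x ^ 2 + t) ^ (-((N : ℝ) + 1) / 2) * Real.log (x ^ 2 + t) := by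
  obtain ⟨M, hM⟩ := hbdd
  have hsol := isBoundedHeatSolution_heatSol hcont hM
  have hg := isRapidDerivSeq_gaussDeriv
  refine ⟨⟨_, hsol⟩, heatCoeff Λ Λp Λm,
    fun n η => (Λp n - Λm n) / (4 * √π) * hermiteFun (n - 1) η,
    fun n _ => ⟨contDiff_heatCoeff Λ Λp Λm n, contDiff_const.mul (contDiff_hermiteFun _)⟩,
    fun n _ η => rfl, fun u hu N => ?_⟩
  obtain ⟨C₁, hC₁, h₁⟩ := exists_abs_integral_Ioi_sub_le hg hcont hp N
  obtain ⟨C₂, hC₂, h₂⟩ := exists_abs_integral_Ioi_sub_le hg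
    (hcont.comp continuous_neg) hm.comp_neg N
  -- As `x² ≥ |x| - 1/4`, the radius `4` guarantees `x² + t ≥ 3`.
  refine ⟨(√π)⁻¹ * ((C₁ + C₂) * 4), 4, fun x t ht hR => ?_⟩
  have hs : 0 < √t := Real.sqrt_pos.2 ht
  set η := x / (2 * √t) with hη
  have hσ : 0 < 2 * √t := by positivity
  have e₁ := h₁ η (2 * √t) hσ
  have e₂ := h₂ (-η) (2 * √t) hσ
  rw [integral_Ioi_gaussDeriv_zero] at e₁ e₂
  rw [abs_neg, neg_neg] at e₂
  have hscale : 2 * √t * (1 + |η|) = 2 * √t + |x| := by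
    rw [hη, abs_div, abs_of_pos hσ]
    field_simp
  rw [hscale] at e₁ e₂
  have hsum : ∑ n ∈ Finset.Icc 1 N, t ^ (-(n : ℝ) / 2) *
      (heatCoeff Λ Λp Λm n η + (Λp n - Λm n) / (4 * √π) * hermiteFun (n - 1) η * Real.log t)
      = (√π)⁻¹ * ((∑ k ∈ Finset.range N, ((2 * √t) ^ (k + 1))⁻¹ *
          (halfLineCoeff gaussDeriv Λ Λp k η
            + Λp (k + 1) * ((-1) ^ k / (k ! : ℝ) * gaussDeriv k η) * Real.log (2 * √t)))
        + ∑ k ∈ Finset.range N, ((2 * √t) ^ (k + 1))⁻¹ *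
          (halfLineCoeff gaussDeriv (fun y => Λ (-y)) (fun n => (-1) ^ n * Λm n) k (-η)
            + (-1) ^ (k + 1) * Λm (k + 1) * ((-1) ^ k / (k ! : ℝ) * gaussDeriv k (-η))
              * Real.log (2 * √t))) := by
    rw [← Finset.sum_add_distrib, Finset.mul_sum, ← Finset.Ico_add_one_right_eq_Icc,
      Finset.sum_Ico_eq_sum_range, Nat.add_sub_cancel]
    refine Finset.sum_congr rfl fun k _ => ?_
    rw [add_comm 1 k, Nat.add_sub_cancel]
    exact heat_term_eq Λ Λp Λm k η ht
  rw [hu.eq_of_pos hsol x t ht, heatSol_eq_add Λ hcont hM x ht, ← hη]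
  simp only [hsum]
  have hfactor : ∀ I₁ I₂ S₁ S₂ : ℝ,
      (√π)⁻¹ * (I₁ + I₂)
          - (Λm 0 * erfc η + Λp 0 * erfc (-η) + (√π)⁻¹ * (S₁ + S₂))
        = (√π)⁻¹ * ((I₁ - Λp 0 * (√π * erfc (-η)) - S₁)
          + (I₂ - (-1) ^ 0 * Λm 0 * (√π * erfc η) - S₂)) := by
    intro I₁ I₂ S₁ S₂
    have : √π ≠ 0 := by positivity
    field_simp
    ring
  rw [hfactor, abs_mul, abs_of_pos (by positivity : 0 < (√π)⁻¹),
    mul_assoc _ (_ ^ (_ : ℝ)), mul_assoc (√π)⁻¹ (_ * 4)]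
  refine mul_le_mul_of_nonneg_left ?_ (by positivity)
  refine (abs_add_le _ _).trans ((add_le_add e₁ e₂).trans ?_)
  -- The parabolic sizes are comparable: `x² + t ≤ (2√t + |x|)² ≤ 8 (x² + t)`.
  have hbound := inv_pow_mul_log_le N (s := 2 * √t + |x|) (q := x ^ 2 + t)
    (by nlinarith [sq_nonneg (|x| - 1 / 2), sq_abs x]) (by positivity)
    (by nlinarith [Real.sq_sqrt ht.le, sq_abs x, mul_nonneg hs.le (abs_nonneg x)])
    (by nlinarith [Real.sq_sqrt ht.le, sq_abs x, sq_nonneg (2 * √t - |x|)])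
  rw [mul_assoc C₁, mul_assoc C₂, ← add_mul, mul_assoc _ (4 : ℝ)]
  exact mul_le_mul_of_nonneg_left hbound (by positivity)
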